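/- **Lemma 5.3.** All drawings are good drawings in the plane (vertices are distinct points, edges are simple arcs joining their ends and containing no other vertex, no two edges cross more than once, and no two edges with a common end cross); edges that meet at a point that is not a vertex cross properly there. A drawing is *1-planar* if every edge is crossed at most once, and a graph is 1-planar if it has a 1-planar drawing. The faces of a drawing are the connected components of its complement in the plane; a face is uncrossed if its boundary contains no crossing. Two drawings are *isomorphic* if a homeomorphism of the sphere maps one to the other. A vertex is *simplicial* if its neighbourhood is a clique. The complete graph $K_4$ is a *4-tree*, and so is every graph $G$ that has a simplicial vertex $u$ of degree $4$ for which $G-u$ is a 4-tree. Let $D$ be a 1-planar drawing. Two uncrossed triangular faces $f_1=[abv_1a]$ and $f_2=[abv_2a]$ of $D$ whose boundaries share exactly one edge, $ab$, are *twin faces* if $\{a,b,v_1,v_2\}$ induces a $K_4$. The *4-join* $D\oplus(f_1,f_2)$ is obtained from $D$ by putting a new vertex $x$ inside $f_1$, drawing the edges $xa$, $xb$, $xv_1$ inside $f_1$, and drawing an edge $xv_2$ inside $f_1\cup f_2$ except that it crosses $ab$ once, such that the four new edges meet one another only in $x$. Let $B$ be the graph with vertices $u_1,\dots,u_7$ in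 which all pairs are adjacent except $u_3u_6$, $u_2u_7$ and $u_3u_7$. Let $B_1$ and $B_2$ be the straight-line drawings of $B$ in which $$u_1=(0,22),\quad u_2=(-12,2),\quad u_3=(12,2),\quad u_4=(-6,5),\quad u_5=(6,5),$$ and $u_6=(0,12)$, $u_7=(2,8)$ in $B_1$, while $u_6=(-2,12)$, $u_7=(2,12)$ in $B_2$. Let $\Phi$ be the smallest class of drawings, closed under isomorphism, that contains $B_1$ and $B_2$ and contains $D\oplus(f_1,f_2)$ and $D\oplus(f_2,f_1)$ whenever it contains $D$ and $f_1,f_2$ are twin faces in $D$. Then every $D\in\Phi$ is a 1-planar drawing, and the graph that it represents is a 1-planar 4-tree with exactly two simplicial vertices. -/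

import Mathlib

universe u v

/-! ### Simplicial vertices and `k`-trees -/

/-- A vertex is simplicial if its neighbourhood is a clique (vacuously so if it has degree `0`). -/
def IsSimplicial {V : Type u} (G : SimpleGraph V) (w : V) : Prop :=
  G.IsClique (G.neighborSet w)

/-- `k`-trees: the smallest one is the complete graph on `k` vertices, and `G` is a `k`-tree if it
has a simplicial vertex `w` of degree `k` such that `G - w` is a `k`-tree. -/
inductive IsKTree (k : ℕ) : {V : Type u} → SimpleGraph V → Prop
  | complete {V : Type u} (hV : ENat.card V = k) : IsKTree k (⊤ : SimpleGraph V)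
  | extend {V : Type u} (G : SimpleGraph V) (w : V) (hs : IsSimplicial G w)
      (hd : (G.neighborSet w).encard = k) (hG : IsKTree k (G.induce {w}ᶜ)) : IsKTree k G

/-! ### Drawings -/

/-- The plane, as a topological space. -/
abbrev Plane : Type := ℝ × ℝ

/-- `S` is a simple arc with ends `p` and `q`. -/
def IsSimpleArc (S : Set Plane) (p q : Plane) : Prop :=
  ∃ γ : Path p q, Function.Injective γ ∧ Set.range γ = S

/-- Near the point `z` the sets `S` and `T` look, after a local homeomorphism, like the two
coordinate axes near their intersection. This is a proper crossing, as opposed to a touching. -/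
def CrossesProperly (S T : Set Plane) (z : Plane) : Prop :=
  ∃ φ : OpenPartialHomeomorph Plane (ℝ × ℝ), z ∈ φ.source ∧ φ z = 0 ∧
    ∀ y ∈ φ.source, (y ∈ S ↔ (φ y).2 = 0) ∧ (y ∈ T ↔ (φ y).1 = 0)

/-- The data of a drawing: a graph, a point for every vertex, and a set of points for every edge.
The values of `arc` at non-edges are irrelevant and are never consulted. That the points are
distinct and that the sets are arcs with the right ends is part of `Drawing.IsGood`. -/
structure Drawing (V : Type u) where
  graph : SimpleGraph V
  point : V → Plane
  arc : Sym2 V → Set Plane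

namespace Drawing

variable {V : Type u} {W : Type v}

/-- The edges `e` and `f` cross at `z`: they are distinct and `z` is a common point of their arcs
which is not a vertex. -/
def CrossAt (D : Drawing V) (e f : Sym2 V) (z : Plane) : Prop :=
  e ∈ D.graph.edgeSet ∧ f ∈ D.graph.edgeSet ∧ e ≠ f ∧ z ∈ D.arc e ∧ z ∈ D.arc f ∧
    z ∉ Set.range D.point

/-- `D` is a good drawing of its graph: vertices are distinct points, an edge is a simple
arc joining its ends and containing no other vertex, edges that meet outside the vertices cross
properly there, no two edges cross more than once, and no two edges with a common end cross. -/
structure IsGood (D : Drawing V) : Prop where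
  point_injective : Function.Injective D.point
  arc_simple : ∀ a b, D.graph.Adj a b → IsSimpleArc (D.arc s(a, b)) (D.point a) (D.point b)
  no_vertex_inside : ∀ e ∈ D.graph.edgeSet, ∀ w, D.point w ∈ D.arc e → w ∈ e
  cross_properly : ∀ e f z, D.CrossAt e f z → CrossesProperly (D.arc e) (D.arc f) z
  cross_once : ∀ e f z z', D.CrossAt e f z → D.CrossAt e f z' → z = z'
  no_adjacent_cross : ∀ e f w z, w ∈ e → w ∈ f → ¬ D.CrossAt e f z

/-- `D` is a 1-planar drawing (a 1-plane graph): a good drawing in which every edge is crossed at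
most once, that is, has at most one crossing with at most one other edge. -/
structure IsOnePlane (D : Drawing V) : Prop where
  good : D.IsGood
  crossed_at_most_once : ∀ e f f' z z', D.CrossAt e f z → D.CrossAt e f' z' → f = f' ∧ z = z'

/-- All points of the plane that lie on the drawing. -/
def carrier (D : Drawing V) : Set Plane :=
  Set.range D.point ∪ ⋃ e ∈ D.graph.edgeSet, D.arc e

/-- The faces are the connected components of the complement of the drawing (including the
unbounded one). -/
def IsFace (D : Drawing V) (F : Set Plane) : Prop :=
  ∃ z ∈ D.carrierᶜ, F = connectedComponentIn D.carrierᶜ z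

/-- A face is uncrossed if there is no crossing on its boundary. -/
def IsUncrossedFace (D : Drawing V) (F : Set Plane) : Prop :=
  D.IsFace F ∧ ∀ e f z, D.CrossAt e f z → z ∉ frontier F

/-- `F` is the uncrossed triangular face `[a b c a]`. -/
def IsUncrossedTriangle (D : Drawing V) (F : Set Plane) (a b c : V) : Prop :=
  D.IsUncrossedFace F ∧ D.graph.Adj a b ∧ D.graph.Adj b c ∧ D.graph.Adj c a ∧
    frontier F = D.arc s(a, b) ∪ D.arc s(b, c) ∪ D.arc s(c, a)

/-- `F₁ = [a b v₁ a]` and `F₂ = [a b v₂ a]` are twin faces: uncrossed triangular faces whose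
boundaries share exactly the one edge `ab` (that is, `v₁ ≠ v₂`), such that `a, b, v₁, v₂` induce
a complete graph on four vertices. -/
def TwinFaces (D : Drawing V) (F₁ F₂ : Set Plane) (a b v₁ v₂ : V) : Prop :=
  D.IsUncrossedTriangle F₁ a b v₁ ∧ D.IsUncrossedTriangle F₂ a b v₂ ∧ v₁ ≠ v₂ ∧
    D.graph.IsClique {a, b, v₁, v₂}

/-- `D'` is a drawing `D ⊕ (F₁, F₂)`, obtained from `D` by the 4-join operation at the ordered pair
of twin faces `F₁ = [a b v₁ a]`, `F₂ = [a b v₂ a]`. The new vertex `x` is `none`; the old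
vertex `w` is `some w`. -/
structure IsFourJoin (D : Drawing V) (F₁ F₂ : Set Plane) (a b v₁ v₂ : V)
    (D' : Drawing (Option V)) : Prop where
  twin : D.TwinFaces F₁ F₂ a b v₁ v₂
  /-- The old part of the drawing is unchanged. -/
  adj_old : ∀ w w', D'.graph.Adj (some w) (some w') ↔ D.graph.Adj w w'
  point_old : ∀ w, D'.point (some w) = D.point w
  arc_old : ∀ e ∈ D.graph.edgeSet, D'.arc (e.map some) = D.arc e
  /-- The new vertex is adjacent exactly to `a`, `b`, `v₁`, `v₂` and is put inside `F₁`. -/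
  adj_new : ∀ w, D'.graph.Adj none (some w) ↔ w = a ∨ w = b ∨ w = v₁ ∨ w = v₂
  point_new : D'.point none ∈ F₁
  /-- The edges `xa`, `xb`, `xv₁` are drawn inside `F₁`. -/
  arc_inside : ∀ w, w = a ∨ w = b ∨ w = v₁ →
    IsSimpleArc (D'.arc s(none, some w)) (D'.point none) (D.point w) ∧
      D'.arc s(none, some w) ⊆ insert (D.point w) F₁
  /-- The edge `xv₂` runs inside `F₁` up to an inner point of `ab`, crosses `ab` there, and then
  runs inside `F₂`. -/
  arc_across : ∃ (γ : Path (D'.point none) (D.point v₂)) (t : unitInterval),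
    Function.Injective γ ∧ Set.range γ = D'.arc s(none, some v₂) ∧ 0 < t ∧ t < 1 ∧
    γ t ∈ D.arc s(a, b) ∧ γ t ≠ D.point a ∧ γ t ≠ D.point b ∧
    (∀ r, r < t → γ r ∈ F₁) ∧ (∀ r, t < r → r < 1 → γ r ∈ F₂) ∧
    CrossesProperly (D'.arc s(none, some v₂)) (D.arc s(a, b)) (γ t)
  /-- The new edges meet each other only in `x`. -/
  new_disjoint : ∀ w w', D'.graph.Adj none (some w) → D'.graph.Adj none (some w') → w ≠ w' →
    D'.arc s(none, some w) ∩ D'.arc s(none, some w') = {D'.point none}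

/-- Two drawings are isomorphic if a homeomorphism of the sphere (the one-point compactification
of the plane) maps one to the other. -/
def Isomorphic (D : Drawing V) (D' : Drawing W) : Prop :=
  ∃ (σ : D.graph ≃g D'.graph) (h : OnePoint Plane ≃ₜ OnePoint Plane),
    (∀ w, h (D.point w : OnePoint Plane) = (D'.point (σ w) : OnePoint Plane)) ∧
    ∀ e ∈ D.graph.edgeSet,
      h '' ((fun p : Plane => (p : OnePoint Plane)) '' D.arc e) =
        (fun p : Plane => (p : OnePoint Plane)) '' D'.arc (e.map σ)

/-- The straight-line drawing of a graph with prescribed positions of the vertices. -/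
def straight (G : SimpleGraph V) (p : V → Plane) : Drawing V where
  graph := G
  point := p
  arc := Sym2.lift ⟨fun a b => segment ℝ (p a) (p b), fun a b => segment_symm ℝ (p a) (p b)⟩

end Drawing

/-- A graph is 1-planar if it has a 1-planar drawing. -/
def IsOnePlanar {V : Type u} (G : SimpleGraph V) : Prop :=
  ∃ D : Drawing V, D.graph = G ∧ D.IsOnePlane

/-! ### The class `Φ` -/

/-- The graph drawn by `B₁` and `B₂`. The vertex `u_i` is `i - 1`, for `i = 1, …, 7`. -/
def graphB : SimpleGraph (Fin 7) :=
  SimpleGraph.fromEdgeSet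
    {s(0, 1), s(1, 2), s(2, 0), s(0, 4), s(4, 2), s(3, 1), s(3, 4), s(5, 3), s(5, 4), s(0, 5),
      s(0, 3), s(5, 1), s(1, 4), s(3, 2), s(6, 0), s(6, 3), s(6, 4), s(6, 5)}

/-- The drawing `B₁`: `u₇` lies inside the triangle `u₄ u₅ u₆`. The crossings are `u₁u₄` with
`u₂u₆`, `u₂u₅` with `u₃u₄`, and `u₁u₇` with `u₅u₆`. -/
def drawingB₁ : Drawing (Fin 7) :=
  Drawing.straight graphB
    ![(0, 22), (-12, 2), (12, 2), (-6, 5), (6, 5), (0, 12), (2, 8)]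

/-- The drawing `B₂`: `u₇` lies inside the triangle `u₁ u₅ u₆`. The crossings are `u₁u₄` with
`u₂u₆`, `u₂u₅` with `u₃u₄`, and `u₄u₇` with `u₅u₆`. -/
def drawingB₂ : Drawing (Fin 7) :=
  Drawing.straight graphB
    ![(0, 22), (-12, 2), (12, 2), (-6, 5), (6, 5), (-2, 12), (2, 12)]

/-- The class `Φ`: up to isomorphism of drawings, the smallest class that contains `B₁` and `B₂`
and is closed under the 4-join operation at any ordered pair of twin faces. -/
inductive Phi : {V : Type u} → Drawing V → Prop
  | base₁ {V : Type u} (D : Drawing V) (h : drawingB₁.Isomorphic D) : Phi D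
  | base₂ {V : Type u} (D : Drawing V) (h : drawingB₂.Isomorphic D) : Phi D
  | join {V : Type u} (D : Drawing V) (F₁ F₂ : Set Plane) (a b v₁ v₂ : V)
      (D' : Drawing (Option V)) (hD : Phi D) (h : D.IsFourJoin F₁ F₂ a b v₁ v₂ D') : Phi D'
  | iso {V W : Type u} (D : Drawing V) (D' : Drawing W) (hD : Phi D)
      (h : D.Isomorphic D') : Phi D'

open Set

/-! ### `k`-trees -/

/-! The proof is an induction over `Phi` with the stronger invariant `Drawing.IsTwoEnded`. Besides
the claim, it says that the two simplicial vertices are not adjacent, that all degrees are at least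
4, that every triangle of uncrossed edges (`FreeTriangle`, not necessarily a face) contains a
simplicial vertex, and that each simplicial vertex lies in at most two such triangles.

Consider a 4-join with new vertex x. Both twin faces are free triangles, so each contains a
simplicial vertex. Since a, b, v₁, v₂ form a clique, only one of them, s, is simplicial, and v₁ ≠ v₂
forces s to be a or b (`exists_simplicial_end`). The vertex x is simplicial. It is also adjacent to
s, so if s stayed simplicial, all old neighbours of s would be among the other three clique
vertices, against the degree bound (`isSimplicial_some_iff`). The other simplicial vertex lies
outside the clique and survives, so x replaces s.

The free triangles at s are exactly the two twin triangles. Both use ab, which x v₂ now crosses, so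
every old triangle that stays free contains the surviving simplicial vertex
(`freeTriangle_of_some`). The free triangles at x are at most x a v₁ and x b v₁
(`freeTriangle_none`). 1-planarity is kept because the only new crossing is that of x v₂ with the
formerly uncrossed ab (`crossAt_cases`).

The invariant passes through sphere homeomorphisms (`IsTwoEnded.of_iso`). For the two base drawings,
crossings of segments in general position are sign conditions on integer determinants, which are
decided by computation. -/

theorem IsSimplicial.of_iso {V : Type u} {W : Type v} {G : SimpleGraph V} {H : SimpleGraph W}
    (σ : G ≃g H) {w : V} (h : IsSimplicial G w) : IsSimplicial H (σ w) := by
  intro x hx y hy hxy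
  have hx' : G.Adj w (σ.symm x) := by rw [← σ.map_adj_iff]; simpa using hx
  have hy' : G.Adj w (σ.symm y) := by rw [← σ.map_adj_iff]; simpa using hy
  have := h hx' hy' (fun h => hxy (σ.symm.injective h))
  rw [← σ.map_adj_iff] at this
  simpa using this

theorem isSimplicial_iso_iff {V : Type u} {W : Type v} {G : SimpleGraph V} {H : SimpleGraph W}
    (σ : G ≃g H) {w : V} : IsSimplicial H (σ w) ↔ IsSimplicial G w :=
  ⟨fun h => by simpa using h.of_iso σ.symm, fun h => h.of_iso σ⟩

theorem neighborSet_iso {V : Type u} {W : Type v} {G : SimpleGraph V} {H : SimpleGraph W}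
    (σ : G ≃g H) (w : V) : H.neighborSet (σ w) = σ '' G.neighborSet w := by
  ext x
  constructor
  · intro hx
    refine ⟨σ.symm x, ?_, by simp⟩
    change G.Adj w (σ.symm x)
    rw [← σ.map_adj_iff]
    simpa using hx
  · rintro ⟨y, hy, rfl⟩
    exact σ.map_adj_iff.2 hy

/-- The restriction of a graph isomorphism to the complements of corresponding vertices. -/
def isoComplSingleton {V : Type u} {W : Type v} {G : SimpleGraph V} {H : SimpleGraph W}
    (σ : G ≃g H) (w : V) : G.induce {w}ᶜ ≃g H.induce {σ w}ᶜ where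
  toEquiv := σ.toEquiv.subtypeEquiv (fun x => by simp)
  map_rel_iff' := by
    rintro ⟨x, hx⟩ ⟨y, hy⟩
    exact σ.map_adj_iff

theorem IsKTree.of_iso {k : ℕ} {V : Type u} {G : SimpleGraph V} (h : IsKTree k G) :
    ∀ {W : Type v} {H : SimpleGraph W}, (G ≃g H) → IsKTree k H := by
  induction h with
  | @complete V hV =>
    intro W H σ
    have : H = ⊤ := by
      ext x y
      rw [← σ.symm.map_adj_iff]
      simp
    subst this
    exact .complete ((ENat.card_congr σ.toEquiv).symm.trans hV)
  | extend G w hs hd hG ih =>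
    intro W H σ
    refine .extend H (σ w) (hs.of_iso σ) ?_ (ih (isoComplSingleton σ w))
    rw [neighborSet_iso, σ.injective.encard_image, hd]

/-- Lets vertices be removed one after another from subsets of a fixed vertex type, without nested
subtypes. -/
theorem IsKTree.induce_extend {k : ℕ} {V : Type u} {G : SimpleGraph V} {S : Set V} {w : V}
    (hw : w ∈ S) (hc : G.IsClique (G.neighborSet w ∩ S))
    (hd : (G.neighborSet w ∩ S).encard = k) (h : IsKTree k (G.induce (S \ {w}))) :
    IsKTree k (G.induce S) := by
  refine .extend _ ⟨w, hw⟩ ?_ ?_ (h.of_iso ?_)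
  · intro x hx y hy hxy
    exact hc ⟨hx, x.2⟩ ⟨hy, y.2⟩ (fun h => hxy (Subtype.ext h))
  · rw [← hd, ← Subtype.val_injective.encard_image]
    congr 1
    ext x
    simp [and_comm]
  · exact
      { toFun := fun x => ⟨⟨x.1, x.2.1⟩, fun h => x.2.2 (congrArg Subtype.val h)⟩
        invFun := fun x => ⟨x.1.1, x.1.2, fun h => x.2 (Subtype.ext h)⟩
        left_inv := fun _ => rfl
        right_inv := fun _ => rfl
        map_rel_iff' := Iff.rfl }

theorem IsKTree.of_induce_univ {k : ℕ} {V : Type u} {G : SimpleGraph V}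
    (h : IsKTree k (G.induce univ)) : IsKTree k G :=
  h.of_iso (SimpleGraph.induceUnivIso G)

/-! ### Transporting drawings along homeomorphisms of the sphere -/

theorem CrossesProperly.symm {S T : Set Plane} {z : Plane} (h : CrossesProperly S T z) :
    CrossesProperly T S z := by
  obtain ⟨φ, hz, h0, hφ⟩ := h
  refine ⟨φ.trans (Homeomorph.prodComm ℝ ℝ).toOpenPartialHomeomorph, by simpa using hz,
    by simp [h0], fun y hy => ?_⟩
  have := hφ y (by simpa using hy)
  exact ⟨by simpa using this.2, by simpa using this.1⟩

section Sphere

variable (h : OnePoint Plane ≃ₜ OnePoint Plane) {S T S' T' : Set Plane}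

/-- A homeomorphism of the sphere may move infinity, so it induces no map of the plane.
Corresponding points are therefore given as pairs `z`, `z'`; points on the arcs always have a
partner, by the next two lemmas. -/
theorem mem_iff_of_image_eq
    (hS : h '' ((fun p : Plane => (p : OnePoint Plane)) '' S) =
      (fun p : Plane => (p : OnePoint Plane)) '' S') {z z' : Plane}
    (hz : h (z : OnePoint Plane) = (z' : OnePoint Plane)) : z ∈ S ↔ z' ∈ S' := by
  rw [← OnePoint.coe_injective.mem_set_image (s := S'), ← hS, ← hz, h.injective.mem_set_image,
    OnePoint.coe_injective.mem_set_image]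

theorem exists_of_mem_of_image_eq
    (hS : h '' ((fun p : Plane => (p : OnePoint Plane)) '' S) =
      (fun p : Plane => (p : OnePoint Plane)) '' S') {z : Plane} (hz : z ∈ S) :
    ∃ z' : Plane, h (z : OnePoint Plane) = (z' : OnePoint Plane) := by
  have : h (z : OnePoint Plane) ∈ (fun p : Plane => (p : OnePoint Plane)) '' S' := by
    rw [← hS]
    exact ⟨_, ⟨z, hz, rfl⟩, rfl⟩
  obtain ⟨z', _, h'⟩ := this
  exact ⟨z', h'.symm⟩

theorem exists_of_mem_of_image_eq'
    (hS : h '' ((fun p : Plane => (p : OnePoint Plane)) '' S) =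
      (fun p : Plane => (p : OnePoint Plane)) '' S') {z' : Plane} (hz : z' ∈ S') :
    ∃ z : Plane, h (z : OnePoint Plane) = (z' : OnePoint Plane) := by
  have : (z' : OnePoint Plane) ∈ (fun p : Plane => (p : OnePoint Plane)) '' S' := ⟨z', hz, rfl⟩
  rw [← hS] at this
  obtain ⟨_, ⟨z, _, rfl⟩, h'⟩ := this
  exact ⟨z, h'⟩

/-- The image of the arc avoids infinity, so the path lifts to the plane; the lift is continuous
because the plane is embedded in the sphere. -/
theorem IsSimpleArc.of_image_eq {p q p' q' : Plane} (ha : IsSimpleArc S p q)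
    (hS : h '' ((fun p : Plane => (p : OnePoint Plane)) '' S) =
      (fun p : Plane => (p : OnePoint Plane)) '' S')
    (hp : h (p : OnePoint Plane) = (p' : OnePoint Plane))
    (hq : h (q : OnePoint Plane) = (q' : OnePoint Plane)) : IsSimpleArc S' p' q' := by
  obtain ⟨γ, hγ, rfl⟩ := ha
  choose g hg using fun t => exists_of_mem_of_image_eq h hS (mem_range_self (f := γ) t)
  have hc : Continuous g := by
    rw [OnePoint.isOpenEmbedding_coe.isInducing.continuous_iff]
    have : (fun p : Plane => (p : OnePoint Plane)) ∘ g = fun t => h (γ t : OnePoint Plane) :=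
      funext fun t => (hg t).symm
    rw [show ((↑) : Plane → OnePoint Plane) ∘ g = fun t => h (γ t : OnePoint Plane) from this]
    exact h.continuous.comp (OnePoint.continuous_coe.comp γ.continuous)
  refine ⟨⟨⟨g, hc⟩, ?_, ?_⟩, ?_, ?_⟩
  · apply OnePoint.coe_injective
    rw [← hp, ← γ.source]
    exact (hg 0).symm
  · apply OnePoint.coe_injective
    rw [← hq, ← γ.target]
    exact (hg 1).symm
  · intro s t hst
    apply hγ
    apply OnePoint.coe_injective
    apply h.injective
    rw [hg, hg]
    exact congrArg _ hst
  · ext y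
    constructor
    · rintro ⟨t, rfl⟩
      exact (mem_iff_of_image_eq h hS (hg t)).1 (mem_range_self t)
    · intro hy
      obtain ⟨z, hz⟩ := exists_of_mem_of_image_eq' h hS hy
      obtain ⟨t, rfl⟩ := (mem_iff_of_image_eq h hS hz).2 hy
      exact ⟨t, OnePoint.coe_injective ((hg t).symm.trans hz)⟩

theorem CrossesProperly.of_image_eq
    (hS : h '' ((fun p : Plane => (p : OnePoint Plane)) '' S) =
      (fun p : Plane => (p : OnePoint Plane)) '' S')
    (hT : h '' ((fun p : Plane => (p : OnePoint Plane)) '' T) =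
      (fun p : Plane => (p : OnePoint Plane)) '' T') {z z' : Plane}
    (hz : h (z : OnePoint Plane) = (z' : OnePoint Plane)) (hc : CrossesProperly S T z) :
    CrossesProperly S' T' z' := by
  obtain ⟨φ, hzφ, h0, hφ⟩ := hc
  let ψ := OnePoint.isOpenEmbedding_coe.toOpenPartialHomeomorph ((↑) : Plane → OnePoint Plane)
  have hψ : ∀ y : Plane, ψ y = (y : OnePoint Plane) := fun y => rfl
  have hψs : ∀ y : Plane, ψ.symm (y : OnePoint Plane) = y := fun y => ψ.left_inv (mem_univ y)
  have hψt : ∀ y : OnePoint Plane, y ∈ ψ.target → ∃ z : Plane, y = z := fun y hy => by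
    exact ⟨ψ.symm y, (ψ.right_inv hy).symm⟩
  have hψm : ∀ y : Plane, (y : OnePoint Plane) ∈ ψ.target := fun y => ψ.map_source (mem_univ y)
  have hsymm : h.symm (z' : OnePoint Plane) = (z : OnePoint Plane) := by rw [← hz]; simp
  -- The old chart is precomposed with the inverse of `h`, restricted to the points of the plane
  -- that this inverse keeps finite.
  refine ⟨((ψ.trans h.symm.toOpenPartialHomeomorph).trans ψ.symm).trans φ, ?_, ?_, ?_⟩
  · simp only [OpenPartialHomeomorph.trans_source, mem_inter_iff, mem_preimage]
    refine ⟨⟨⟨mem_univ _, mem_univ _⟩, ?_⟩, ?_⟩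
    · change h.symm (ψ z') ∈ ψ.target
      rw [hψ, hsymm]
      exact hψm z
    · change ψ.symm (h.symm (ψ z')) ∈ φ.source
      rwa [hψ, hsymm, hψs]
  · change φ (ψ.symm (h.symm (ψ z'))) = 0
    rw [hψ, hsymm, hψs, h0]
  · intro y hy
    simp only [OpenPartialHomeomorph.trans_source, mem_inter_iff, mem_preimage] at hy
    obtain ⟨⟨-, hy1⟩, hy2⟩ := hy
    change h.symm (ψ y) ∈ ψ.target at hy1
    change ψ.symm (h.symm (ψ y)) ∈ φ.source at hy2
    change (y ∈ S' ↔ (φ (ψ.symm (h.symm (ψ y)))).2 = 0) ∧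
      (y ∈ T' ↔ (φ (ψ.symm (h.symm (ψ y)))).1 = 0)
    obtain ⟨x, hx⟩ := hψt _ hy1
    rw [hx, hψs] at hy2 ⊢
    have hxy : h (x : OnePoint Plane) = (y : OnePoint Plane) := by rw [← hx]; simp [hψ]
    rw [← mem_iff_of_image_eq h hS hxy, ← mem_iff_of_image_eq h hT hxy]
    exact hφ x hy2

end Sphere

namespace Drawing

variable {V : Type u} {W : Type v}

theorem map_mem_edgeSet {G : SimpleGraph V} {H : SimpleGraph W} (σ : G ≃g H) (e : Sym2 V) :
    e.map σ ∈ H.edgeSet ↔ e ∈ G.edgeSet := by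
  induction e with
  | _ a b => exact σ.map_adj_iff

theorem exists_map_eq {G : SimpleGraph V} {H : SimpleGraph W} (σ : G ≃g H) (e : Sym2 W) :
    ∃ e' : Sym2 V, e'.map σ = e := by
  refine ⟨e.map σ.symm, ?_⟩
  induction e with
  | _ a b => simp

section Iso

variable {D : Drawing V} {D' : Drawing W} (σ : D.graph ≃g D'.graph)
  (h : OnePoint Plane ≃ₜ OnePoint Plane)
  (hp : ∀ w, h (D.point w : OnePoint Plane) = (D'.point (σ w) : OnePoint Plane))
  (ha : ∀ e ∈ D.graph.edgeSet,
      h '' ((fun p : Plane => (p : OnePoint Plane)) '' D.arc e) =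
        (fun p : Plane => (p : OnePoint Plane)) '' D'.arc (e.map σ))

include hp ha

theorem crossAt_iff_of_iso {e f : Sym2 V} {z z' : Plane}
    (hz : h (z : OnePoint Plane) = (z' : OnePoint Plane)) :
    D.CrossAt e f z ↔ D'.CrossAt (e.map σ) (f.map σ) z' := by
  unfold CrossAt
  rw [map_mem_edgeSet, map_mem_edgeSet, (Sym2.map.injective σ.injective).ne_iff]
  refine and_congr_right fun he => and_congr_right fun hf => and_congr_right fun _ => ?_
  rw [mem_iff_of_image_eq h (ha e he) hz, mem_iff_of_image_eq h (ha f hf) hz]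
  refine and_congr_right fun _ => and_congr_right fun _ => not_congr ⟨?_, ?_⟩
  · rintro ⟨w, rfl⟩
    exact ⟨σ w, OnePoint.coe_injective ((hp w).symm.trans hz)⟩
  · rintro ⟨w, rfl⟩
    obtain ⟨w, rfl⟩ := σ.surjective w
    exact ⟨w, OnePoint.coe_injective (h.injective ((hp w).trans hz.symm))⟩

theorem exists_crossAt_of_iso {e f : Sym2 V} {z : Plane} (hc : D.CrossAt e f z) :
    ∃ z' : Plane, h (z : OnePoint Plane) = (z' : OnePoint Plane) ∧
      D'.CrossAt (e.map σ) (f.map σ) z' := by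
  obtain ⟨z', hz⟩ := exists_of_mem_of_image_eq h (ha e hc.1) hc.2.2.2.1
  exact ⟨z', hz, (crossAt_iff_of_iso σ h hp ha hz).1 hc⟩

theorem exists_crossAt_of_iso' {e f : Sym2 V} {z' : Plane}
    (hc : D'.CrossAt (e.map σ) (f.map σ) z') :
    ∃ z : Plane, h (z : OnePoint Plane) = (z' : OnePoint Plane) ∧ D.CrossAt e f z := by
  obtain ⟨z, hz⟩ := exists_of_mem_of_image_eq' h (ha e ((map_mem_edgeSet σ e).1 hc.1)) hc.2.2.2.1
  exact ⟨z, hz, (crossAt_iff_of_iso σ h hp ha hz).2 hc⟩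

theorem IsOnePlane.of_iso (hD : D.IsOnePlane) : D'.IsOnePlane := by
  refine ⟨⟨?_, ?_, ?_, ?_, ?_, ?_⟩, ?_⟩
  · intro w w' hw
    obtain ⟨w, rfl⟩ := σ.surjective w
    obtain ⟨w', rfl⟩ := σ.surjective w'
    congr 1
    apply hD.good.point_injective
    apply OnePoint.coe_injective
    apply h.injective
    rw [hp, hp, hw]
  · intro a b hab
    obtain ⟨a, rfl⟩ := σ.surjective a
    obtain ⟨b, rfl⟩ := σ.surjective b
    have hab := σ.map_adj_iff.1 hab
    exact (hD.good.arc_simple a b hab).of_image_eq h (ha s(a, b) hab) (hp a) (hp b)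
  · intro e he w hw
    obtain ⟨e, rfl⟩ := exists_map_eq σ e
    obtain ⟨w, rfl⟩ := σ.surjective w
    have he := (map_mem_edgeSet σ e).1 he
    exact Sym2.mem_map.2 ⟨w, hD.good.no_vertex_inside e he w
      ((mem_iff_of_image_eq h (ha e he) (hp w)).2 hw), rfl⟩
  · intro e f z' hc
    obtain ⟨e, rfl⟩ := exists_map_eq σ e
    obtain ⟨f, rfl⟩ := exists_map_eq σ f
    obtain ⟨z, hz, hc⟩ := exists_crossAt_of_iso' σ h hp ha hc
    exact (hD.good.cross_properly e f z hc).of_image_eq h (ha e hc.1) (ha f hc.2.1) hz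
  · intro e f z z' hc hc'
    obtain ⟨e, rfl⟩ := exists_map_eq σ e
    obtain ⟨f, rfl⟩ := exists_map_eq σ f
    obtain ⟨y, hy, hc⟩ := exists_crossAt_of_iso' σ h hp ha hc
    obtain ⟨y', hy', hc'⟩ := exists_crossAt_of_iso' σ h hp ha hc'
    apply OnePoint.coe_injective
    rw [← hy, ← hy', hD.good.cross_once e f y y' hc hc']
  · intro e f w z he hf hc
    obtain ⟨e, rfl⟩ := exists_map_eq σ e
    obtain ⟨f, rfl⟩ := exists_map_eq σ f
    obtain ⟨y, hy, hc⟩ := exists_crossAt_of_iso' σ h hp ha hc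
    obtain ⟨w, hw, rfl⟩ := Sym2.mem_map.1 he
    obtain ⟨w', hw', heq⟩ := Sym2.mem_map.1 hf
    obtain rfl := σ.injective heq
    exact hD.good.no_adjacent_cross e f w' y hw hw' hc
  · intro e f f' z z' hc hc'
    obtain ⟨e, rfl⟩ := exists_map_eq σ e
    obtain ⟨f, rfl⟩ := exists_map_eq σ f
    obtain ⟨f', rfl⟩ := exists_map_eq σ f'
    obtain ⟨y, hy, hc⟩ := exists_crossAt_of_iso' σ h hp ha hc
    obtain ⟨y', hy', hc'⟩ := exists_crossAt_of_iso' σ h hp ha hc'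
    obtain ⟨rfl, rfl⟩ := hD.crossed_at_most_once e f f' y y' hc hc'
    exact ⟨rfl, OnePoint.coe_injective (hy.symm.trans hy')⟩

end Iso

/-! ### Free triangles and the inductive invariant -/

/-- `abc` is a triangle of the graph none of whose edges is crossed in the drawing. -/
structure FreeTriangle (D : Drawing V) (a b c : V) : Prop where
  adj : D.graph.Adj a b ∧ D.graph.Adj b c ∧ D.graph.Adj c a
  uncrossed : ∀ f z, ¬ D.CrossAt s(a, b) f z ∧ ¬ D.CrossAt s(b, c) f z ∧ ¬ D.CrossAt s(c, a) f z

theorem FreeTriangle.rotate {D : Drawing V} {a b c : V} (h : D.FreeTriangle a b c) :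
    D.FreeTriangle b c a :=
  ⟨⟨h.adj.2.1, h.adj.2.2, h.adj.1⟩,
    fun f z => ⟨(h.uncrossed f z).2.1, (h.uncrossed f z).2.2, (h.uncrossed f z).1⟩⟩

theorem FreeTriangle.swap {D : Drawing V} {a b c : V} (h : D.FreeTriangle a b c) :
    D.FreeTriangle b a c := by
  refine ⟨⟨h.adj.1.symm, h.adj.2.2.symm, h.adj.2.1.symm⟩, fun f z => ?_⟩
  rw [Sym2.eq_swap (a := b) (b := a), Sym2.eq_swap (a := a) (b := c), Sym2.eq_swap (a := c) (b := b)]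
  exact ⟨(h.uncrossed f z).1, (h.uncrossed f z).2.2, (h.uncrossed f z).2.1⟩

/-- The boundary of the face consists of the three entire edges, so a crossing on any of them would
lie on the boundary. -/
theorem IsUncrossedTriangle.freeTriangle {D : Drawing V} {F : Set Plane} {a b c : V}
    (h : D.IsUncrossedTriangle F a b c) : D.FreeTriangle a b c := by
  obtain ⟨⟨-, hF⟩, hab, hbc, hca, hfr⟩ := h
  rw [hfr] at hF
  exact ⟨⟨hab, hbc, hca⟩, fun f z => ⟨fun hc => hF _ _ _ hc (.inl (.inl hc.2.2.2.1)),
    fun hc => hF _ _ _ hc (.inl (.inr hc.2.2.2.1)), fun hc => hF _ _ _ hc (.inr hc.2.2.2.1)⟩⟩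

/-- The properties shared by all drawings in `Φ` that are preserved by the 4-join. -/
structure IsTwoEnded (D : Drawing V) : Prop where
  onePlane : D.IsOnePlane
  kTree : IsKTree 4 D.graph
  encard_simplicial : {w : V | IsSimplicial D.graph w}.encard = 2
  not_adj : ∀ s t, IsSimplicial D.graph s → IsSimplicial D.graph t → ¬ D.graph.Adj s t
  four_le : ∀ w, 4 ≤ (D.graph.neighborSet w).encard
  exists_simplicial : ∀ a b c, D.FreeTriangle a b c →
    IsSimplicial D.graph a ∨ IsSimplicial D.graph b ∨ IsSimplicial D.graph c
  two_triangles : ∀ s, IsSimplicial D.graph s → ∃ e e' : Sym2 V, ∀ b c,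
    D.FreeTriangle s b c → s(b, c) = e ∨ s(b, c) = e'

theorem IsTwoEnded.of_iso {D : Drawing V} {D' : Drawing W} (hD : D.IsTwoEnded)
    (hi : D.Isomorphic D') : D'.IsTwoEnded := by
  obtain ⟨σ, h, hp, ha⟩ := hi
  have hfree : ∀ a b c, D'.FreeTriangle (σ a) (σ b) (σ c) → D.FreeTriangle a b c := by
    rintro a b c ⟨⟨h1, h2, h3⟩, hu⟩
    refine ⟨⟨σ.map_adj_iff.1 h1, σ.map_adj_iff.1 h2, σ.map_adj_iff.1 h3⟩, fun f z => ?_⟩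
    refine ⟨fun hc => ?_, fun hc => ?_, fun hc => ?_⟩ <;>
      obtain ⟨z', -, hc'⟩ := exists_crossAt_of_iso σ h hp ha hc
    exacts [(hu _ z').1 hc', (hu _ z').2.1 hc', (hu _ z').2.2 hc']
  refine ⟨hD.onePlane.of_iso σ h hp ha, hD.kTree.of_iso σ, ?_, ?_, ?_, ?_, ?_⟩
  · rw [← hD.encard_simplicial, ← σ.injective.encard_image]
    congr 1
    ext w
    obtain ⟨w, rfl⟩ := σ.surjective w
    rw [σ.injective.mem_set_image]
    exact isSimplicial_iso_iff σ
  · intro s t hs ht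
    obtain ⟨s, rfl⟩ := σ.surjective s
    obtain ⟨t, rfl⟩ := σ.surjective t
    rw [σ.map_adj_iff]
    exact hD.not_adj s t ((isSimplicial_iso_iff σ).1 hs) ((isSimplicial_iso_iff σ).1 ht)
  · intro w
    obtain ⟨w, rfl⟩ := σ.surjective w
    rw [neighborSet_iso, σ.injective.encard_image]
    exact hD.four_le w
  · intro a b c hf
    obtain ⟨a, rfl⟩ := σ.surjective a
    obtain ⟨b, rfl⟩ := σ.surjective b
    obtain ⟨c, rfl⟩ := σ.surjective c
    simp only [isSimplicial_iso_iff]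
    exact hD.exists_simplicial a b c (hfree _ _ _ hf)
  · intro s hs
    obtain ⟨s, rfl⟩ := σ.surjective s
    obtain ⟨e, e', he⟩ := hD.two_triangles s ((isSimplicial_iso_iff σ).1 hs)
    refine ⟨e.map σ, e'.map σ, fun b c hf => ?_⟩
    obtain ⟨b, rfl⟩ := σ.surjective b
    obtain ⟨c, rfl⟩ := σ.surjective c
    rw [← Sym2.map_mk]
    exact (he b c (hfree _ _ _ hf)).imp (congrArg _) (congrArg _)

end Drawing

/-! ### The 4-join preserves the invariant -/

namespace Drawing

variable {V : Type u}

theorem arc_subset_carrier {D : Drawing V} {e : Sym2 V} (he : e ∈ D.graph.edgeSet) :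
    D.arc e ⊆ D.carrier := fun _ hz => .inr (mem_biUnion he hz)

theorem point_mem_carrier (D : Drawing V) (w : V) : D.point w ∈ D.carrier :=
  .inl (mem_range_self w)

theorem IsFace.notMem_carrier {D : Drawing V} {F : Set Plane} (hF : D.IsFace F) {z : Plane}
    (hz : z ∈ F) : z ∉ D.carrier := by
  obtain ⟨y, -, rfl⟩ := hF
  exact connectedComponentIn_subset _ _ hz

namespace CrossAt

theorem symm {D : Drawing V} {e f : Sym2 V} {z : Plane} (h : D.CrossAt e f z) :
    D.CrossAt f e z :=
  ⟨h.2.1, h.1, h.2.2.1.symm, h.2.2.2.2.1, h.2.2.2.1, h.2.2.2.2.2⟩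

end CrossAt

namespace IsFourJoin

variable {D : Drawing V} {F₁ F₂ : Set Plane} {a b v₁ v₂ : V} {D' : Drawing (Option V)}
  (h : D.IsFourJoin F₁ F₂ a b v₁ v₂ D')

include h

theorem notMem_carrier₁ {z : Plane} (hz : z ∈ F₁) : z ∉ D.carrier :=
  h.twin.1.1.1.notMem_carrier hz

theorem notMem_carrier₂ {z : Plane} (hz : z ∈ F₂) : z ∉ D.carrier :=
  h.twin.2.1.1.1.notMem_carrier hz

theorem new_point_notMem : D'.point none ∉ D.carrier := h.notMem_carrier₁ h.point_new

theorem map_some_mem {e : Sym2 V} : e.map some ∈ D'.graph.edgeSet ↔ e ∈ D.graph.edgeSet := by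
  induction e with
  | _ x y => exact h.adj_old x y

theorem range_point : range D'.point = insert (D'.point none) (range D.point) := by
  ext z
  constructor
  · rintro ⟨_ | w, rfl⟩
    · exact mem_insert _ _
    · exact .inr ⟨w, (h.point_old w).symm⟩
  · rintro (rfl | ⟨w, rfl⟩)
    · exact mem_range_self _
    · exact ⟨some w, h.point_old w⟩

theorem edge_cases {e : Sym2 (Option V)} (he : e ∈ D'.graph.edgeSet) :
    (∃ e₀ ∈ D.graph.edgeSet, e = e₀.map some) ∨
      ∃ w, (w = a ∨ w = b ∨ w = v₁ ∨ w = v₂) ∧ e = s(none, some w) := by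
  induction e with
  | _ x y =>
    have he : D'.graph.Adj x y := he
    cases x with
    | none =>
      cases y with
      | none => exact (D'.graph.loopless.irrefl _ he).elim
      | some y => exact .inr ⟨y, (h.adj_new y).1 he, rfl⟩
    | some x =>
      cases y with
      | none => exact .inr ⟨x, (h.adj_new x).1 he.symm, Sym2.eq_swap⟩
      | some y => exact .inl ⟨s(x, y), (h.adj_old x y).1 he, rfl⟩

theorem crossAt_map_some_iff {e f : Sym2 V} {z : Plane} :
    D'.CrossAt (e.map some) (f.map some) z ↔ D.CrossAt e f z := by
  unfold CrossAt
  rw [h.map_some_mem, h.map_some_mem, (Sym2.map.injective (Option.some_injective V)).ne_iff]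
  refine and_congr_right fun he => and_congr_right fun hf => and_congr_right fun _ => ?_
  rw [h.arc_old e he, h.arc_old f hf, h.range_point]
  refine and_congr_right fun hz => and_congr_right fun _ => not_congr ⟨?_, .inr⟩
  rintro (rfl | hz')
  · exact (h.new_point_notMem (arc_subset_carrier he hz)).elim
  · exact hz'

/-- Faces avoid the drawing, so a new edge can meet the old drawing only at its old end, or at the
point `z₀` where x v₂ passes from `F₁` to `F₂`. -/
theorem exists_crossing (hD : D.IsGood) : ∃ z₀ ∈ D.arc s(a, b),
    IsSimpleArc (D'.arc s(none, some v₂)) (D'.point none) (D.point v₂) ∧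
    z₀ ∉ range D.point ∧ CrossesProperly (D'.arc s(none, some v₂)) (D.arc s(a, b)) z₀ ∧
    z₀ ∈ D'.arc s(none, some v₂) ∧
    ∀ w, (w = a ∨ w = b ∨ w = v₁ ∨ w = v₂) → ∀ z ∈ D'.arc s(none, some w),
      z ∉ D.carrier ∨ z = D.point w ∨ w = v₂ ∧ z = z₀ := by
  obtain ⟨γ, t, hγ, hr, -, -, hab, ha, hb, h₁, h₂, hc⟩ := h.arc_across
  refine ⟨γ t, hab, ⟨γ, hγ, hr⟩, ?_, hc, hr ▸ mem_range_self t, ?_⟩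
  · rintro ⟨w, hw⟩
    have := hD.no_vertex_inside s(a, b) h.twin.1.2.1 w (hw ▸ hab)
    rcases Sym2.mem_iff.1 this with rfl | rfl
    exacts [ha hw.symm, hb hw.symm]
  · intro w hw z hz
    by_cases hwv : w = v₂
    · subst hwv
      rw [← hr] at hz
      obtain ⟨r, rfl⟩ := hz
      rcases lt_trichotomy r t with hrt | rfl | hrt
      · exact .inl (h.notMem_carrier₁ (h₁ r hrt))
      · exact .inr (.inr ⟨rfl, rfl⟩)
      · rcases (unitInterval.le_one' (t := r)).lt_or_eq with hr1 | rfl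
        · exact .inl (h.notMem_carrier₂ (h₂ r hrt hr1))
        · exact .inr (.inl γ.target)
    · have hw : w = a ∨ w = b ∨ w = v₁ := by tauto
      rcases (h.arc_inside w hw).2 hz with rfl | hz
      · exact .inr (.inl rfl)
      · exact .inl (h.notMem_carrier₁ hz)

theorem adj_a : D.graph.Adj a b := h.twin.1.2.1

theorem isClique : D.graph.IsClique {a, b, v₁, v₂} := h.twin.2.2.2

theorem ne_a : v₂ ≠ a := h.twin.2.1.2.2.2.1.ne

theorem ne_b : v₂ ≠ b := h.twin.2.1.2.2.1.ne'

theorem crossAt_cases (hD : D.IsGood) : ∃ z₀, D'.CrossAt s(none, some v₂) s(some a, some b) z₀ ∧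
    CrossesProperly (D'.arc s(none, some v₂)) (D'.arc s(some a, some b)) z₀ ∧
    ∀ e f z, D'.CrossAt e f z →
      (∃ e₀ f₀, e = e₀.map some ∧ f = f₀.map some ∧ D.CrossAt e₀ f₀ z) ∨
      (e = s(none, some v₂) ∧ f = s(some a, some b) ∧ z = z₀) ∨
      (f = s(none, some v₂) ∧ e = s(some a, some b) ∧ z = z₀) := by
  obtain ⟨z₀, hz₀, -, hv, hp, hz₀', hc⟩ := h.exists_crossing hD
  have harc : D'.arc s(some a, some b) = D.arc s(a, b) := h.arc_old s(a, b) h.adj_a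
  have key : ∀ w, (w = a ∨ w = b ∨ w = v₁ ∨ w = v₂) → ∀ f₀ ∈ D.graph.edgeSet, ∀ z,
      D'.CrossAt s(none, some w) (f₀.map some) z → w = v₂ ∧ f₀ = s(a, b) ∧ z = z₀ := by
    rintro w hw f₀ hf z ⟨-, -, -, hz, hzf, hzv⟩
    rw [h.arc_old f₀ hf] at hzf
    rcases hc w hw z hz with h1 | rfl | ⟨rfl, rfl⟩
    · exact (h1 (arc_subset_carrier hf hzf)).elim
    · exact (hzv ⟨some w, h.point_old w⟩).elim
    · refine ⟨rfl, ?_, rfl⟩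
      by_contra hne
      -- Any other old edge through `z₀` would already have crossed ab in `D`.
      exact (h.twin.1.freeTriangle.uncrossed f₀ z).1
        ⟨h.adj_a, hf, fun h => hne h.symm, hz₀, hzf, hv⟩
  refine ⟨z₀, ⟨(h.adj_new v₂).2 (by tauto), (h.adj_old a b).2 h.adj_a, by simp, hz₀',
    harc ▸ hz₀, ?_⟩, harc ▸ hp, ?_⟩
  · rw [h.range_point]
    rintro (rfl | hz)
    · exact h.new_point_notMem (arc_subset_carrier h.adj_a hz₀)
    · exact hv hz
  · intro e f z hx
    rcases h.edge_cases hx.1 with ⟨e₀, he, rfl⟩ | ⟨w, hw, rfl⟩ <;>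
      rcases h.edge_cases hx.2.1 with ⟨f₀, hf, rfl⟩ | ⟨w', hw', rfl⟩
    · exact .inl ⟨e₀, f₀, rfl, rfl, h.crossAt_map_some_iff.1 hx⟩
    · obtain ⟨rfl, rfl, rfl⟩ := key w' hw' e₀ he z hx.symm
      exact .inr (.inr ⟨rfl, rfl, rfl⟩)
    · obtain ⟨rfl, rfl, rfl⟩ := key w hw f₀ hf z hx
      exact .inr (.inl ⟨rfl, rfl, rfl⟩)
    · obtain ⟨-, -, hne, hz, hz', hzv⟩ := hx
      have := h.new_disjoint w w' ((h.adj_new w).2 hw) ((h.adj_new w').2 hw')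
        (fun h => hne (by rw [h]))
      have hz : z ∈ ({D'.point none} : Set Plane) := this ▸ ⟨hz, hz'⟩
      exact (hzv ⟨none, hz.symm⟩).elim

theorem isOnePlane (hD : D.IsOnePlane) : D'.IsOnePlane := by
  obtain ⟨z₀, hx₀, hp, hc⟩ := h.crossAt_cases hD.good
  have hab := (h.twin.1.freeTriangle.uncrossed · · |>.1)
  have hne : ∀ e : Sym2 V, s(none, some v₂) ≠ e.map some := by
    intro e he
    have : none ∈ e.map some := he ▸ Sym2.mem_mk_left _ _
    simp [Sym2.mem_map] at this
  have habm : s(some a, some b) = (s(a, b)).map some := rfl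
  have hsome : ∀ {x y : Sym2 V}, x.map some = y.map some → x = y :=
    fun h => Sym2.map.injective (Option.some_injective V) h
  -- Old crossings are controlled by `D`; a new one cannot coincide in an edge with an old one,
  -- since x v₂ is new and ab was uncrossed.
  have once : ∀ e f f' z z', D'.CrossAt e f z → D'.CrossAt e f' z' → f = f' ∧ z = z' := by
    intro e f f' z z' h1 h2
    rcases hc _ _ _ h1 with ⟨e₀, f₀, rfl, rfl, k1⟩ | ⟨rfl, rfl, rfl⟩ | ⟨rfl, rfl, rfl⟩ <;>
      rcases hc _ _ _ h2 with ⟨e₁, f₁, he, rfl, k2⟩ | ⟨he, rfl, rfl⟩ | ⟨rfl, he, rfl⟩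
    · obtain rfl := hsome he
      obtain ⟨rfl, rfl⟩ := hD.crossed_at_most_once _ _ _ _ _ k1 k2
      exact ⟨rfl, rfl⟩
    · exact (hne _ he.symm).elim
    · obtain rfl := hsome (he.trans habm)
      exact (hab _ _ k1).elim
    · exact (hne _ he).elim
    · exact ⟨rfl, rfl⟩
    · exact (hne _ (he.trans habm)).elim
    · obtain rfl := hsome (habm.symm.trans he)
      exact (hab _ _ k2).elim
    · exact (hne _ (he.symm.trans habm)).elim
    · exact ⟨rfl, rfl⟩
  obtain ⟨y₀, -, hv₂, -⟩ := h.exists_crossing hD.good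
  have new_arc : ∀ w, (w = a ∨ w = b ∨ w = v₁ ∨ w = v₂) →
      IsSimpleArc (D'.arc s(none, some w)) (D'.point none) (D.point w) := by
    intro w hw
    by_cases hwv : w = v₂
    · exact hwv ▸ hv₂
    · exact (h.arc_inside w (by tauto)).1
  refine ⟨⟨?_, ?_, ?_, ?_, fun e f z z' h1 h2 => (once e f f z z' h1 h2).2, ?_⟩, once⟩
  · have hn : ∀ w, D'.point none ≠ D'.point (some w) := fun w hw =>
      h.new_point_notMem (hw ▸ h.point_old w ▸ D.point_mem_carrier w)
    rintro (_ | w) (_ | w') hw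
    · rfl
    · exact (hn w' hw).elim
    · exact (hn w hw.symm).elim
    · rw [h.point_old, h.point_old] at hw
      rw [hD.good.point_injective hw]
  · rintro (_ | x) (_ | y) hxy
    · exact (D'.graph.loopless.irrefl _ hxy).elim
    · rw [h.point_old]
      exact new_arc y ((h.adj_new y).1 hxy)
    · obtain ⟨γ, hγ, hr⟩ := new_arc x ((h.adj_new x).1 hxy.symm)
      rw [h.point_old, Sym2.eq_swap]
      exact ⟨γ.symm, hγ.comp unitInterval.symm_bijective.injective, by rw [Path.symm_range, hr]⟩
    · have hxy := (h.adj_old x y).1 hxy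
      rw [h.point_old, h.point_old, show s(some x, some y) = (s(x, y)).map some from rfl,
        h.arc_old _ hxy]
      exact hD.good.arc_simple x y hxy
  · intro e he w hw
    rcases h.edge_cases he with ⟨e, he₀, rfl⟩ | ⟨w', hw', rfl⟩
    · rw [h.arc_old e he₀] at hw
      cases w with
      | none => exact (h.new_point_notMem (arc_subset_carrier he₀ hw)).elim
      | some w =>
        rw [h.point_old] at hw
        exact Sym2.mem_map.2 ⟨w, hD.good.no_vertex_inside e he₀ w hw, rfl⟩
    · cases w with
      | none => exact Sym2.mem_mk_left _ _
      | some w =>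
        by_cases hww : w = w'
        · exact hww ▸ Sym2.mem_mk_right _ _
        obtain ⟨z₁, -, -, hv, -, -, hc⟩ := h.exists_crossing hD.good
        rw [h.point_old] at hw
        rcases hc w' hw' _ hw with h1 | h1 | ⟨-, h1⟩
        · exact (h1 (D.point_mem_carrier w)).elim
        · exact (hww (hD.good.point_injective h1)).elim
        · exact (hv ⟨w, h1⟩).elim
  · intro e f z hx
    rcases hc _ _ _ hx with ⟨e, f, rfl, rfl, k⟩ | ⟨rfl, rfl, rfl⟩ | ⟨rfl, rfl, rfl⟩
    · rw [h.arc_old e k.1, h.arc_old f k.2.1]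
      exact hD.good.cross_properly e f z k
    · exact hp
    · exact hp.symm
  · intro e f w z he hf hx
    have : ∀ w, w ∈ s(none, some v₂) → w ∉ s(some a, some b) := by
      intro w h1 h2
      rcases Sym2.mem_iff.1 h1 with rfl | rfl
      · simp at h2
      · rcases Sym2.mem_iff.1 h2 with h2 | h2
        exacts [h.ne_a (Option.some_injective _ h2), h.ne_b (Option.some_injective _ h2)]
    rcases hc _ _ _ hx with ⟨e, f, rfl, rfl, k⟩ | ⟨rfl, rfl, rfl⟩ | ⟨rfl, rfl, rfl⟩
    · obtain ⟨w, hw, rfl⟩ := Sym2.mem_map.1 he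
      obtain ⟨w', hw', heq⟩ := Sym2.mem_map.1 hf
      obtain rfl := Option.some_injective _ heq
      exact hD.good.no_adjacent_cross e f w' z hw hw' k
    · exact this _ he hf
    · exact this _ hf he

theorem neighborSet_none : D'.graph.neighborSet none = some '' {a, b, v₁, v₂} := by
  ext (_ | w)
  · simp
  · simpa using h.adj_new w

theorem encard_eq_four : ({a, b, v₁, v₂} : Set V).encard = 4 := by
  have h1 := h.adj_a.ne
  have h2 := h.twin.1.2.2.1.ne
  have h3 := h.twin.1.2.2.2.1.ne'
  have h4 := h.ne_a.symm
  have h5 := h.ne_b.symm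
  rw [encard_insert_of_notMem (by simp [*]), encard_insert_of_notMem (by simp [*]),
    encard_pair h.twin.2.2.1]
  norm_num

theorem isSimplicial_none : IsSimplicial D'.graph none := by
  rw [IsSimplicial, h.neighborSet_none]
  rintro _ ⟨x, hx, rfl⟩ _ ⟨y, hy, rfl⟩ hxy
  exact (h.adj_old x y).2 (h.isClique hx hy (fun h => hxy (by rw [h])))

theorem isKTree (hD : IsKTree 4 D.graph) : IsKTree 4 D'.graph := by
  refine .extend _ none h.isSimplicial_none ?_ (hD.of_iso ?_)
  · rw [h.neighborSet_none, (Option.some_injective V).encard_image, h.encard_eq_four]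
    norm_num
  · exact
      { toEquiv := Equiv.ofBijective (fun w => ⟨some w, by simp⟩)
          ⟨fun x y hxy => by simpa using hxy, fun ⟨x, hx⟩ => by
            cases x with
            | none => simp at hx
            | some x => exact ⟨x, rfl⟩⟩
        map_rel_iff' := h.adj_old _ _ }

/-- A vertex of the clique sees the new vertex. If it were simplicial, its old neighbours would be
adjacent to the new vertex too, leaving room for only three of them. -/
theorem isSimplicial_some_iff (h4 : ∀ w, 4 ≤ (D.graph.neighborSet w).encard) (w : V) :
    IsSimplicial D'.graph (some w) ↔
      IsSimplicial D.graph w ∧ w ∉ ({a, b, v₁, v₂} : Set V) := by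
  constructor
  · intro hs
    refine ⟨fun x hx y hy hxy => (h.adj_old x y).1 (hs ((h.adj_old w x).2 hx)
      ((h.adj_old w y).2 hy) (by simpa using hxy)), fun hw => ?_⟩
    have hn : D'.graph.Adj (some w) none := ((h.adj_new w).2 hw).symm
    have hsub : D.graph.neighborSet w ⊆ {a, b, v₁, v₂} \ {w} := by
      intro x hx
      refine ⟨(h.adj_new x).1 (hs hn ((h.adj_old w x).2 hx) (by simp)), ?_⟩
      rintro rfl
      exact D.graph.loopless.irrefl _ hx
    have h1 := (h4 w).trans (encard_le_encard hsub)
    have h2 := encard_sdiff_singleton_add_one hw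
    rw [h.encard_eq_four] at h2
    -- The count ends in 4 + 1 ≤ 4.
    have h3 := add_le_add_left h1 1
    rw [h2] at h3
    norm_num at h3
  · rintro ⟨hs, hw⟩ (_ | x) hx (_ | y) hy hxy
    · exact (hxy rfl).elim
    · exact (hw ((h.adj_new w).1 (D'.graph.adj_symm hx))).elim
    · exact (hw ((h.adj_new w).1 (D'.graph.adj_symm hy))).elim
    · exact (h.adj_old x y).2 (hs ((h.adj_old w x).1 hx) ((h.adj_old w y).1 hy)
        (fun h => hxy (by rw [h])))

theorem freeTriangle_of_some (hD : D.IsGood) {x y z : V}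
    (hf : D'.FreeTriangle (some x) (some y) (some z)) :
    D.FreeTriangle x y z ∧ s(x, y) ≠ s(a, b) := by
  obtain ⟨⟨h1, h2, h3⟩, hu⟩ := hf
  obtain ⟨z₀, hx₀, -⟩ := h.crossAt_cases hD
  refine ⟨⟨⟨(h.adj_old _ _).1 h1, (h.adj_old _ _).1 h2, (h.adj_old _ _).1 h3⟩, fun f p =>
    ⟨fun hc => ?_, fun hc => ?_, fun hc => ?_⟩⟩, fun hxy => ?_⟩
  · exact (hu (f.map some) p).1 (h.crossAt_map_some_iff.2 hc)
  · exact (hu (f.map some) p).2.1 (h.crossAt_map_some_iff.2 hc)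
  · exact (hu (f.map some) p).2.2 (h.crossAt_map_some_iff.2 hc)
  · have := congrArg (Sym2.map some) hxy
    simp only [Sym2.map_mk] at this
    exact (hu _ z₀).1 (this ▸ hx₀.symm)

theorem freeTriangle_none (hD : D.IsGood) {x y : Option V} (hf : D'.FreeTriangle none x y) :
    s(x, y) = s(some a, some v₁) ∨ s(x, y) = s(some b, some v₁) := by
  obtain ⟨⟨h1, h2, h3⟩, hu⟩ := hf
  obtain ⟨z₀, hx₀, -⟩ := h.crossAt_cases hD
  cases x with
  | none => exact (D'.graph.loopless.irrefl _ h1).elim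
  | some x =>
  cases y with
  | none => exact (D'.graph.loopless.irrefl _ h3).elim
  | some y =>
  have hx : x ≠ v₂ := by
    rintro rfl
    exact (hu _ z₀).1 hx₀
  have hy : y ≠ v₂ := by
    rintro rfl
    exact (hu _ z₀).2.2 (Sym2.eq_swap (a := none) ▸ hx₀)
  have hxy : s(x, y) ≠ s(a, b) := fun hxy => by
    have := congrArg (Sym2.map some) hxy
    simp only [Sym2.map_mk] at this
    exact (hu _ z₀).2.1 (this ▸ hx₀.symm)
  have hne : x ≠ y := fun h => h2.ne (by rw [h])
  have hx' := (h.adj_new x).1 h1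
  have hy' := (h.adj_new y).1 h3.symm
  rcases hx' with rfl | rfl | rfl | rfl <;> rcases hy' with rfl | rfl | rfl | rfl <;> simp_all

/-- The two triangles at a 4-join are the only uncrossed ones at a simplicial vertex. -/
theorem exists_simplicial_end (hD : D.IsTwoEnded) : ∃ s, IsSimplicial D.graph s ∧
    s ∈ ({a, b, v₁, v₂} : Set V) ∧
    ∀ x y, D.FreeTriangle s x y → s(s, x) = s(a, b) ∨ s(s, y) = s(a, b) := by
  have t₁ := h.twin.1.freeTriangle
  have t₂ := h.twin.2.1.freeTriangle
  have hadj : ∀ s t, s ∈ ({a, b, v₁, v₂} : Set V) → t ∈ ({a, b, v₁, v₂} : Set V) →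
      IsSimplicial D.graph s → IsSimplicial D.graph t → s = t := by
    intro s t hs ht h1 h2
    by_contra hne
    exact hD.not_adj s t h1 h2 (h.isClique hs ht hne)
  have hv : v₁ ≠ v₂ := h.twin.2.2.1
  -- If neither a nor b were simplicial, v₁ and v₂ would both be, although they are adjacent.
  have hend : IsSimplicial D.graph a ∨ IsSimplicial D.graph b := by
    rcases hD.exists_simplicial _ _ _ t₁ with h1 | h1 | h1
    · exact .inl h1
    · exact .inr h1
    rcases hD.exists_simplicial _ _ _ t₂ with h2 | h2 | h2
    · exact .inl h2
    · exact .inr h2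
    exact (hv (hadj _ _ (by simp) (by simp) h1 h2)).elim
  -- The twin triangles have different edges opposite to `s`, so they use up both possibilities
  -- allowed by `two_triangles`; any further free triangle at `s` coincides with one of them.
  have key : ∀ s t, IsSimplicial D.graph s → s(s, t) = s(a, b) → D.FreeTriangle s t v₁ →
      D.FreeTriangle s t v₂ → ∀ x y, D.FreeTriangle s x y →
        s(s, x) = s(a, b) ∨ s(s, y) = s(a, b) := by
    intro s t hs hst h1 h2 x y h3
    obtain ⟨e, e', he⟩ := hD.two_triangles s hs
    have hne : s(t, v₁) ≠ s(t, v₂) := fun h => hv (Sym2.congr_right.1 h)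
    have h4 : s(x, y) = s(t, v₁) ∨ s(x, y) = s(t, v₂) := by
      rcases he _ _ h1 with k1 | k1 <;> rcases he _ _ h2 with k2 | k2 <;>
        rcases he _ _ h3 with k3 | k3 <;>
        first
        | exact (hne (k1.trans k2.symm)).elim
        | exact .inl (k3.trans k1.symm)
        | exact .inr (k3.trans k2.symm)
    have h5 : t ∈ s(x, y) := by
      rcases h4 with h4 | h4 <;> rw [h4] <;> exact Sym2.mem_mk_left _ _
    rw [← hst]
    rcases Sym2.mem_iff.1 h5 with rfl | rfl
    · exact .inl rfl
    · exact .inr rfl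
  rcases hend with hs | hs
  · exact ⟨a, hs, by simp, key a b hs rfl t₁ t₂⟩
  · exact ⟨b, hs, by simp, key b a hs Sym2.eq_swap t₁.swap t₂.swap⟩

theorem isTwoEnded (hD : D.IsTwoEnded) : D'.IsTwoEnded := by
  have hsimp := h.isSimplicial_some_iff hD.four_le
  obtain ⟨s, hs, hsm, htri⟩ := h.exists_simplicial_end hD
  have honly : ∀ t, IsSimplicial D.graph t → t ≠ s → IsSimplicial D'.graph (some t) :=
    fun t ht hts => (hsimp t).2 ⟨ht, fun hm => hD.not_adj t s ht hs (h.isClique hm hsm hts)⟩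
  -- All free triangles at `s` contained ab, which is now crossed. Hence the simplicial vertex found
  -- in a surviving triangle is not `s`.
  have hfree : ∀ x y z, D'.FreeTriangle (some x) (some y) (some z) → x ≠ s := by
    rintro x y z hf rfl
    rcases htri y z (h.freeTriangle_of_some hD.onePlane.good hf).1 with h1 | h1
    · exact (h.freeTriangle_of_some hD.onePlane.good hf).2 h1
    · exact (h.freeTriangle_of_some hD.onePlane.good hf.rotate.rotate).2
        (Sym2.eq_swap.trans h1)
  have hnone : ∀ t, IsSimplicial D'.graph (some t) → ¬ D'.graph.Adj none (some t) :=
    fun t ht hn => ((hsimp t).1 ht).2 ((h.adj_new t).1 hn)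
  refine ⟨h.isOnePlane hD.onePlane, h.isKTree hD.kTree, ?_, ?_, ?_, ?_, ?_⟩
  -- The new vertex replaces `s`, so the number of simplicial vertices is unchanged.
  · have heq : {w | IsSimplicial D'.graph w} =
        insert none (some '' ({w | IsSimplicial D.graph w} \ {s})) := by
      ext (_ | w)
      · simpa using h.isSimplicial_none
      · simp only [mem_ofPred_eq, mem_insert_iff, reduceCtorEq, false_or,
          (Option.some_injective V).mem_set_image, mem_sdiff, mem_singleton_iff]
        exact ⟨fun hw => ⟨((hsimp w).1 hw).1, fun hws => ((hsimp w).1 hw).2 (hws ▸ hsm)⟩,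
          fun hw => honly w hw.1 hw.2⟩
    rw [heq, encard_insert_of_notMem (by simp), (Option.some_injective V).encard_image,
      encard_sdiff_singleton_add_one hs, hD.encard_simplicial]
  · rintro (_ | x) (_ | y) hx hy hxy
    · exact D'.graph.loopless.irrefl _ hxy
    · exact hnone y hy hxy
    · exact hnone x hx hxy.symm
    · exact hD.not_adj x y ((hsimp x).1 hx).1 ((hsimp y).1 hy).1 ((h.adj_old x y).1 hxy)
  · rintro (_ | w)
    · rw [h.neighborSet_none, (Option.some_injective V).encard_image, h.encard_eq_four]
    · refine (hD.four_le w).trans ?_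
      rw [← (Option.some_injective V).encard_image]
      refine encard_le_encard ?_
      rintro _ ⟨x, hx, rfl⟩
      exact (h.adj_old w x).2 hx
  · rintro (_ | x) (_ | y) (_ | z) hf
    iterate 4 exact .inl h.isSimplicial_none
    · exact .inr (.inl h.isSimplicial_none)
    · exact .inr (.inl h.isSimplicial_none)
    · exact .inr (.inr h.isSimplicial_none)
    · rcases hD.exists_simplicial x y z (h.freeTriangle_of_some hD.onePlane.good hf).1 with
        h1 | h1 | h1
      · exact .inl (honly x h1 (hfree _ _ _ hf))
      · exact .inr (.inl (honly y h1 (hfree _ _ _ hf.rotate)))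
      · exact .inr (.inr (honly z h1 (hfree _ _ _ hf.rotate.rotate)))
  · rintro (_ | t) ht
    · exact ⟨_, _, fun x y hf => h.freeTriangle_none hD.onePlane.good hf⟩
    · obtain ⟨e, e', he⟩ := hD.two_triangles t ((hsimp t).1 ht).1
      refine ⟨e.map some, e'.map some, ?_⟩
      rintro (_ | x) (_ | y) hf
      · exact (hnone t ht hf.adj.1.symm).elim
      · exact (hnone t ht hf.adj.1.symm).elim
      · exact (hnone t ht hf.adj.2.2).elim
      · rw [← Sym2.map_mk]
        exact (he x y (h.freeTriangle_of_some hD.onePlane.good hf).1).imp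
          (congrArg _) (congrArg _)

end IsFourJoin
end Drawing

/-! ### Straight-line drawings in general position -/

/-- Twice the signed area of the triangle `p q r`. -/
def signedArea {R : Type*} [CommRing R] (p q r : R × R) : R :=
  (q.1 - p.1) * (r.2 - p.2) - (q.2 - p.2) * (r.1 - p.1)

theorem signedArea_segment {p q r s z : Plane} (hz : z ∈ segment ℝ r s) :
    ∃ x y : ℝ, 0 ≤ x ∧ 0 ≤ y ∧ x + y = 1 ∧ z = x • r + y • s ∧
      signedArea p q z = x * signedArea p q r + y * signedArea p q s := by
  obtain ⟨x, y, hx, hy, hxy, rfl⟩ := hz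
  refine ⟨x, y, hx, hy, hxy, rfl, ?_⟩
  obtain rfl : y = 1 - x := by linarith
  simp only [signedArea, Prod.fst_add, Prod.snd_add, Prod.smul_fst, Prod.smul_snd, smul_eq_mul]
  ring

theorem signedArea_eq_zero {p q z : Plane} (hz : z ∈ segment ℝ p q) : signedArea p q z = 0 := by
  obtain ⟨x, y, -, -, -, -, h⟩ := signedArea_segment (p := p) (q := q) hz
  rw [h]
  simp only [signedArea]
  ring

theorem eq_of_mem_segment_of_mem_segment {p q r z : Plane} (h : signedArea p q r ≠ 0)
    (hq : z ∈ segment ℝ p q) (hr : z ∈ segment ℝ p r) : z = p := by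
  obtain ⟨x, y, -, -, hxy, rfl, h'⟩ := signedArea_segment (p := p) (q := q) hr
  rw [signedArea_eq_zero hq, signedArea_eq_zero (left_mem_segment ℝ p q)] at h'
  have hy : y = 0 := by
    simpa [h] using h'.symm
  subst hy
  obtain rfl : x = 1 := by linarith
  simp

theorem signedArea_mul_nonpos {p q r s z : Plane} (hz : z ∈ segment ℝ p q)
    (hz' : z ∈ segment ℝ r s) : signedArea p q r * signedArea p q s ≤ 0 := by
  obtain ⟨x, y, hx, hy, hxy, -, h⟩ := signedArea_segment (p := p) (q := q) hz'
  rw [signedArea_eq_zero hz] at h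
  by_contra! hlt
  rcases hx.eq_or_lt with rfl | hx
  · obtain rfl : y = 1 := by linarith
    rcases pos_and_pos_or_neg_and_neg_of_mul_pos hlt with ⟨h1, h2⟩ | ⟨h1, h2⟩ <;> linarith
  · rcases pos_and_pos_or_neg_and_neg_of_mul_pos hlt with ⟨h1, h2⟩ | ⟨h1, h2⟩ <;>
      nlinarith

/-- The segments `pq` and `rs` cross in an inner point of both. -/
def SegmentsCross {R : Type*} [CommRing R] [LT R] (p q r s : R × R) : Prop :=
  signedArea p q r * signedArea p q s < 0 ∧ signedArea r s p * signedArea r s q < 0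

theorem mul_div_sub_mul_div {m n x y K c d : ℝ} (hK : K ≠ 0) (e : ℝ)
    (h : m * y - n * x = e * K) : m * (y / K - c) - n * (x / K - d) = e - (m * c - n * d) := by
  have : m * (y / K - c) - n * (x / K - d) = (m * y - n * x) / K - (m * c - n * d) := by ring
  rw [this, h, mul_div_cancel_right₀ _ hK]

/-- The affine coordinate system in which the lines `rs` and `pq` are the axes. -/
noncomputable def axisChart (p q r s : Plane)
    (hK : (q.1 - p.1) * (s.2 - r.2) - (q.2 - p.2) * (s.1 - r.1) ≠ 0) : Plane ≃ₜ ℝ × ℝ where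
  toFun y := (signedArea r s y, signedArea p q y)
  invFun w :=
    -- Cramer's rule for the two linear equations that prescribe the signed areas; the denominator
    -- is the determinant of the two directions.
    (((s.1 - r.1) * (w.2 + (q.1 - p.1) * p.2 - (q.2 - p.2) * p.1) -
      (q.1 - p.1) * (w.1 + (s.1 - r.1) * r.2 - (s.2 - r.2) * r.1)) /
      ((q.1 - p.1) * (s.2 - r.2) - (q.2 - p.2) * (s.1 - r.1)),
    ((s.2 - r.2) * (w.2 + (q.1 - p.1) * p.2 - (q.2 - p.2) * p.1) -
      (q.2 - p.2) * (w.1 + (s.1 - r.1) * r.2 - (s.2 - r.2) * r.1)) /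
      ((q.1 - p.1) * (s.2 - r.2) - (q.2 - p.2) * (s.1 - r.1)))
  left_inv y := by
    simp only [signedArea]
    ext
    · rw [div_eq_iff hK]
      ring
    · rw [div_eq_iff hK]
      ring
  right_inv w := by
    simp only [signedArea]
    ext
    · refine (mul_div_sub_mul_div hK (w.1 + (s.1 - r.1) * r.2 - (s.2 - r.2) * r.1) ?_).trans ?_ <;>
        ring
    · refine (mul_div_sub_mul_div hK (w.2 + (q.1 - p.1) * p.2 - (q.2 - p.2) * p.1) ?_).trans ?_ <;>
        ring
  continuous_toFun := by
    unfold signedArea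
    fun_prop
  continuous_invFun := by fun_prop

/-- The determinant is the difference of the two signed areas, which have opposite signs. -/
theorem cross_ne_zero {p q r s : Plane} (h : signedArea p q r * signedArea p q s < 0) :
    (q.1 - p.1) * (s.2 - r.2) - (q.2 - p.2) * (s.1 - r.1) ≠ 0 := by
  intro hK
  have : signedArea p q r = signedArea p q s := by
    simp only [signedArea]
    linarith
  rw [this] at h
  nlinarith [mul_self_nonneg (signedArea p q s)]

theorem eq_of_signedArea_eq {p q r s y z : Plane} (h : signedArea p q r * signedArea p q s < 0)
    (h1 : signedArea p q y = signedArea p q z) (h2 : signedArea r s y = signedArea r s z) :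
    y = z :=
  (axisChart p q r s (cross_ne_zero h)).injective (Prod.ext h2 h1)

/-- Along the line pq the signed area relative to rs is affine. Its value at `y` lies strictly
between those at `p` and `q`, so `y` lies between `p` and `q`. -/
theorem mem_segment_of_signedArea {p q r s y : Plane}
    (h : signedArea p q r * signedArea p q s < 0) (h0 : signedArea p q y = 0)
    (h1 : (signedArea r s y - signedArea r s p) * (signedArea r s y - signedArea r s q) < 0) :
    y ∈ segment ℝ p q := by
  set A := signedArea r s p with hA
  set B := signedArea r s q with hB
  set c := signedArea r s y with hc
  have hAB : B - A ≠ 0 := by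
    intro hAB
    rw [show B = A by linarith] at h1
    nlinarith [mul_self_nonneg (c - A)]
  have ht : 0 ≤ (c - A) / (B - A) ∧ (c - A) / (B - A) ≤ 1 := by
    rcases mul_neg_iff.1 h1 with ⟨h2, h3⟩ | ⟨h2, h3⟩
    · exact ⟨div_nonneg (by linarith) (by linarith), (div_le_one (by linarith)).2 (by linarith)⟩
    · exact ⟨div_nonneg_of_nonpos (by linarith) (by linarith),
        (div_le_one_of_neg (by linarith)).2 (by linarith)⟩
  have hm : AffineMap.lineMap p q ((c - A) / (B - A)) ∈ segment ℝ p q := by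
    rw [segment_eq_image_lineMap]
    exact mem_image_of_mem _ ht
  convert hm
  refine eq_of_signedArea_eq h (by rw [h0, signedArea_eq_zero hm]) ?_
  have : signedArea r s (AffineMap.lineMap p q ((c - A) / (B - A))) =
      A + (c - A) / (B - A) * (B - A) := by
    rw [hA, hB]
    simp only [signedArea, AffineMap.lineMap_apply, vsub_eq_sub, vadd_eq_add, Prod.fst_add,
      Prod.snd_add, Prod.smul_fst, Prod.smul_snd, Prod.fst_sub, Prod.snd_sub, smul_eq_mul]
    ring
  rw [this, div_mul_cancel₀ _ hAB]
  ring

theorem SegmentsCross.exists_mem {p q r s : Plane} (h : SegmentsCross p q r s) :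
    ∃ z, z ∈ segment ℝ p q ∧ z ∈ segment ℝ r s := by
  let φ := axisChart p q r s (cross_ne_zero h.1)
  have hφ := φ.apply_symm_apply (0, 0)
  have h1 : signedArea r s (φ.symm (0, 0)) = 0 := congrArg Prod.fst hφ
  have h2 : signedArea p q (φ.symm (0, 0)) = 0 := congrArg Prod.snd hφ
  refine ⟨φ.symm (0, 0), mem_segment_of_signedArea h.1 h2 ?_,
    mem_segment_of_signedArea h.2 h1 ?_⟩
  · rw [h1]
    linarith [h.2]
  · rw [h2]
    linarith [h.1]

theorem SegmentsCross.unique {p q r s z z' : Plane} (h : SegmentsCross p q r s)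
    (h1 : z ∈ segment ℝ p q) (h2 : z ∈ segment ℝ r s) (h1' : z' ∈ segment ℝ p q)
    (h2' : z' ∈ segment ℝ r s) : z = z' :=
  eq_of_signedArea_eq h.1 (by rw [signedArea_eq_zero h1, signedArea_eq_zero h1'])
    (by rw [signedArea_eq_zero h2, signedArea_eq_zero h2'])

theorem SegmentsCross.crossesProperly {p q r s z : Plane} (h : SegmentsCross p q r s)
    (h1 : z ∈ segment ℝ p q) (h2 : z ∈ segment ℝ r s) :
    CrossesProperly (segment ℝ p q) (segment ℝ r s) z := by
  let φ := axisChart p q r s (cross_ne_zero h.1)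
  -- On this neighbourhood each coordinate stays strictly between its values at the ends of a
  -- segment, so there the segments coincide with their lines, the axes of the chart.
  let U : Set Plane := {y |
    (signedArea r s y - signedArea r s p) * (signedArea r s y - signedArea r s q) < 0} ∩
    {y | (signedArea p q y - signedArea p q r) * (signedArea p q y - signedArea p q s) < 0}
  have hU : IsOpen U := by
    unfold U signedArea
    exact (isOpen_lt (by fun_prop) (by fun_prop)).inter (isOpen_lt (by fun_prop) (by fun_prop))
  have hz1 := signedArea_eq_zero h1
  have hz2 := signedArea_eq_zero h2
  refine ⟨φ.toOpenPartialHomeomorph.restrOpen U hU, ⟨mem_univ _, ?_, ?_⟩, Prod.ext hz2 hz1, ?_⟩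
  · change (signedArea r s z - signedArea r s p) * (signedArea r s z - signedArea r s q) < 0
    rw [hz2]
    linarith [h.2]
  · change (signedArea p q z - signedArea p q r) * (signedArea p q z - signedArea p q s) < 0
    rw [hz1]
    linarith [h.1]
  · rintro y ⟨-, hy1, hy2⟩
    exact ⟨⟨signedArea_eq_zero, fun h0 => mem_segment_of_signedArea h.1 h0 hy1⟩,
      ⟨signedArea_eq_zero, fun h0 => mem_segment_of_signedArea h.2 h0 hy2⟩⟩

theorem isSimpleArc_segment {p q : Plane} (h : p ≠ q) : IsSimpleArc (segment ℝ p q) p q := by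
  refine ⟨⟨⟨fun t => AffineMap.lineMap p q (t : ℝ), by fun_prop⟩, by simp, by simp⟩, ?_, ?_⟩
  · intro s t hst
    exact Subtype.ext (AffineMap.lineMap_injective ℝ h hst)
  · rw [segment_eq_image_lineMap]
    ext z
    simp [unitInterval]

/-! ### Crossings when no three vertices are collinear -/

namespace Drawing

variable {V : Type u} {G : SimpleGraph V} {p : V → Plane}

theorem arc_straight (a b : V) : (straight G p).arc s(a, b) = segment ℝ (p a) (p b) := rfl

theorem eq_or_eq_of_mem_segment
    (hg : ∀ a b c, a ≠ b → b ≠ c → c ≠ a → signedArea (p a) (p b) (p c) ≠ 0) {a b w : V}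
    (hab : a ≠ b) (hw : p w ∈ segment ℝ (p a) (p b)) : w = a ∨ w = b := by
  by_contra! hne
  exact hg a b w hab hne.2.symm hne.1 (signedArea_eq_zero hw)

variable (hp : Function.Injective p)
  (hg : ∀ a b c, a ≠ b → b ≠ c → c ≠ a → signedArea (p a) (p b) (p c) ≠ 0)

include hg

/-- Edges with a common end meet only there. For four distinct ends, meeting segments give products
of signed areas that are at most 0, and general position makes them strict. -/
theorem crossAt_straight_iff {a b c d : V} {z : Plane} :
    (straight G p).CrossAt s(a, b) s(c, d) z ↔ G.Adj a b ∧ G.Adj c d ∧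
      SegmentsCross (p a) (p b) (p c) (p d) ∧ z ∈ segment ℝ (p a) (p b) ∧
      z ∈ segment ℝ (p c) (p d) := by
  constructor
  · rintro ⟨hab, hcd, hne, h1, h2, hz⟩
    have hab : G.Adj a b := hab
    have hcd : G.Adj c d := hcd
    rw [arc_straight] at h1 h2
    have hz : ∀ w, z ≠ p w := fun w hw => hz ⟨w, hw.symm⟩
    have key : ∀ x y w, x ≠ y → x ≠ w → s(x, y) ≠ s(x, w) → z ∈ segment ℝ (p x) (p y) →
        z ∉ segment ℝ (p x) (p w) := fun x y w hxy hxw hne hy hw =>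
      hz x (eq_of_mem_segment_of_mem_segment
        (hg x y w hxy (fun h => hne (by rw [h])) hxw.symm) hy hw)
    have h1' := segment_symm ℝ (p a) (p b) ▸ h1
    have h2' := segment_symm ℝ (p c) (p d) ▸ h2
    have hac : a ≠ c := by
      rintro rfl
      exact key _ _ _ hab.ne hcd.ne hne h1 h2
    have had : a ≠ d := by
      rintro rfl
      exact key _ _ _ hab.ne hcd.ne' (Sym2.eq_swap (a := a) (b := c) ▸ hne) h1 h2'
    have hbc : b ≠ c := by
      rintro rfl
      exact key _ _ _ hab.ne' hcd.ne (Sym2.eq_swap (a := b) (b := a) ▸ hne) h1' h2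
    have hbd : b ≠ d := by
      rintro rfl
      exact key _ _ _ hab.ne' hcd.ne' (by rwa [Sym2.eq_swap, Sym2.eq_swap (a := b)]) h1' h2'
    exact ⟨hab, hcd, ⟨(signedArea_mul_nonpos h1 h2).lt_of_ne
      (mul_ne_zero (hg a b c hab.ne hbc hac.symm) (hg a b d hab.ne hbd had.symm)),
      (signedArea_mul_nonpos h2 h1).lt_of_ne
      (mul_ne_zero (hg c d a hcd.ne had.symm hac) (hg c d b hcd.ne hbd.symm hbc))⟩, h1, h2⟩
  · rintro ⟨hab, hcd, hx, h1, h2⟩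
    obtain ⟨hx1, hx2⟩ := mul_ne_zero_iff.1 hx.1.ne
    obtain ⟨hx3, hx4⟩ := mul_ne_zero_iff.1 hx.2.ne
    refine ⟨hab, hcd, fun heq => ?_, h1, h2, ?_⟩
    · have : c ∈ s(a, b) := heq ▸ Sym2.mem_mk_left c d
      rcases Sym2.mem_iff.1 this with rfl | rfl
      · exact hx1 (signedArea_eq_zero (left_mem_segment ℝ _ _))
      · exact hx1 (signedArea_eq_zero (right_mem_segment ℝ _ _))
    · rintro ⟨w, rfl⟩
      rcases eq_or_eq_of_mem_segment hg hab.ne h1 with rfl | rfl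
      · exact hx3 (signedArea_eq_zero h2)
      · exact hx4 (signedArea_eq_zero h2)

include hp in
theorem isGood_straight : (straight G p).IsGood := by
  refine ⟨hp, fun a b hab => isSimpleArc_segment (hp.ne hab.ne), ?_, ?_, ?_, ?_⟩
  · intro e he w hw
    induction e with
    | _ a b =>
      have he : G.Adj a b := he
      exact Sym2.mem_iff.2 (eq_or_eq_of_mem_segment hg he.ne hw)
  · intro e f z hc
    induction e with
    | _ a b =>
      induction f with
      | _ c d =>
        obtain ⟨-, -, hx, h1, h2⟩ := (crossAt_straight_iff hg).1 hc
        exact hx.crossesProperly h1 h2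
  · intro e f z z' hc hc'
    induction e with
    | _ a b =>
      induction f with
      | _ c d =>
        obtain ⟨-, -, hx, h1, h2⟩ := (crossAt_straight_iff hg).1 hc
        obtain ⟨-, -, -, h1', h2'⟩ := (crossAt_straight_iff hg).1 hc'
        exact hx.unique h1 h2 h1' h2'
  · intro e f w z he hf hc
    obtain ⟨a, rfl⟩ := Sym2.mem_iff_exists.1 he
    obtain ⟨b, rfl⟩ := Sym2.mem_iff_exists.1 hf
    obtain ⟨-, -, hx, -⟩ := (crossAt_straight_iff hg).1 hc
    exact (mul_ne_zero_iff.1 hx.1.ne).1 (signedArea_eq_zero (left_mem_segment ℝ _ _))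

end Drawing

/-! ### The base drawings -/

/-- Moves the sign conditions from the reals to the integers, where they are decidable. -/
theorem signedArea_cast (p q r : ℤ × ℤ) :
    signedArea ((p.1 : ℝ), (p.2 : ℝ)) ((q.1 : ℝ), (q.2 : ℝ)) ((r.1 : ℝ), (r.2 : ℝ)) =
      (signedArea p q r : ℤ) := by
  simp [signedArea]

theorem segmentsCross_cast (p q r s : ℤ × ℤ) :
    SegmentsCross ((p.1 : ℝ), (p.2 : ℝ)) ((q.1 : ℝ), (q.2 : ℝ)) ((r.1 : ℝ), (r.2 : ℝ))
      ((s.1 : ℝ), (s.2 : ℝ)) ↔ SegmentsCross p q r s := by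
  simp only [SegmentsCross, signedArea_cast]
  norm_cast

instance (p q r s : ℤ × ℤ) : Decidable (SegmentsCross p q r s) :=
  inferInstanceAs (Decidable (_ ∧ _))

instance : DecidableRel graphB.Adj := fun a b =>
  decidable_of_iff (s(a, b) ∈ ([s(0, 1), s(1, 2), s(2, 0), s(0, 4), s(4, 2), s(3, 1), s(3, 4),
    s(5, 3), s(5, 4), s(0, 5), s(0, 3), s(5, 1), s(1, 4), s(3, 2), s(6, 0), s(6, 3), s(6, 4),
    s(6, 5)] : List (Sym2 (Fin 7))) ∧ a ≠ b) (by
      rw [graphB, SimpleGraph.fromEdgeSet_adj]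
      simp only [List.mem_cons, List.not_mem_nil, or_false, mem_insert_iff, mem_singleton_iff])

instance (w : Fin 7) : Decidable (IsSimplicial graphB w) :=
  decidable_of_iff (∀ x, graphB.Adj w x → ∀ y, graphB.Adj w y → x ≠ y → graphB.Adj x y) Iff.rfl

theorem isSimplicial_graphB_iff : ∀ w, IsSimplicial graphB w ↔ w = 2 ∨ w = 6 := by
  decide +kernel

theorem encard_eq_of_finset {V : Type*} {S : Set V} (T : Finset V) (n : ℕ) (h : S = T)
    (hn : T.card = n) : S.encard = n := by
  rw [h, encard_coe_eq_coe_finsetCard, hn]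

theorem isKTree_graphB : IsKTree 4 graphB := by
  have key : ∀ (S : Finset (Fin 7)) (w : Fin 7), w ∈ S →
      (∀ x ∈ S, graphB.Adj w x → ∀ y ∈ S, graphB.Adj w y → x ≠ y → graphB.Adj x y) →
      (S.filter (graphB.Adj w)).card = 4 →
      IsKTree 4 (graphB.induce ((S.erase w : Finset _) : Set (Fin 7))) →
      IsKTree 4 (graphB.induce (S : Set (Fin 7))) := by
    intro S w hw hc hd h
    refine IsKTree.induce_extend (w := w) hw
      (fun x hx y hy hxy => hc x hx.2 hx.1 y hy.2 hy.1 hxy) ?_ (by rwa [← Finset.coe_erase])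
    refine encard_eq_of_finset _ _ ?_ hd
    ext x
    simp [and_comm]
  apply IsKTree.of_induce_univ
  rw [← Finset.coe_univ]
  -- Elimination order u₇, u₃, u₆; what remains is the complete graph on u₁, u₂, u₄, u₅.
  refine key _ 6 (by decide) (by decide +kernel) (by decide +kernel) ?_
  refine key _ 2 (by decide) (by decide +kernel) (by decide +kernel) ?_
  refine key _ 5 (by decide) (by decide +kernel) (by decide +kernel) ?_
  have hK : ∀ x ∈ ((Finset.univ.erase 6).erase 2).erase (5 : Fin 7),
      ∀ y ∈ ((Finset.univ.erase 6).erase 2).erase (5 : Fin 7), graphB.Adj x y ↔ x ≠ y := by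
    decide +kernel
  have : graphB.induce ((((Finset.univ.erase 6).erase 2).erase (5 : Fin 7) : Finset _) :
      Set (Fin 7)) = ⊤ := by
    ext x y
    rw [SimpleGraph.comap_adj, SimpleGraph.top_adj, ne_eq, Subtype.ext_iff]
    exact hK x x.2 y y.2
  rw [this]
  exact .complete (encard_eq_of_finset _ 4 rfl (by decide +kernel))

namespace Drawing

/-- A straight-line drawing of `graphB` is two-ended, if the integer coordinates of its vertices
pass finitely many checks; `partner e` is the edge crossed by `e`. -/
theorem isTwoEnded_straight_graphB (P : Fin 7 → ℤ × ℤ) (hP : Function.Injective P)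
    (hg : ∀ a b c, a ≠ b → b ≠ c → c ≠ a → signedArea (P a) (P b) (P c) ≠ 0)
    (partner : Sym2 (Fin 7) → Sym2 (Fin 7))
    (hpart : ∀ a b, graphB.Adj a b → ∀ c d, graphB.Adj c d →
      SegmentsCross (P a) (P b) (P c) (P d) → s(c, d) = partner s(a, b))
    (crossed : Sym2 (Fin 7) → Bool)
    (hcr : ∀ a b, graphB.Adj a b → crossed s(a, b) = true → ∃ c d, graphB.Adj c d ∧
      SegmentsCross (P a) (P b) (P c) (P d))
    (htri : ∀ a b c, graphB.Adj a b → graphB.Adj b c → graphB.Adj c a →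
      crossed s(a, b) = false → crossed s(b, c) = false → crossed s(c, a) = false →
      (a = 2 ∨ a = 6) ∨ (b = 2 ∨ b = 6) ∨ (c = 2 ∨ c = 6))
    (e e' : Fin 7 → Sym2 (Fin 7))
    (htwo : ∀ s, (s = 2 ∨ s = 6) → ∀ b c, graphB.Adj s b → graphB.Adj b c → graphB.Adj c s →
      crossed s(s, b) = false → crossed s(b, c) = false → crossed s(c, s) = false →
      s(b, c) = e s ∨ s(b, c) = e' s) :
    (straight graphB fun i => ((P i).1, (P i).2)).IsTwoEnded := by
  set p : Fin 7 → Plane := fun i => ((P i).1, (P i).2) with hp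
  have hpi : Function.Injective p := by
    intro i j hij
    simp only [hp, Prod.mk.injEq, Int.cast_inj] at hij
    exact hP (Prod.ext hij.1 hij.2)
  have hpg : ∀ a b c, a ≠ b → b ≠ c → c ≠ a → signedArea (p a) (p b) (p c) ≠ 0 := by
    intro a b c h1 h2 h3
    rw [hp, signedArea_cast]
    exact_mod_cast hg a b c h1 h2 h3
  have hx : ∀ a b c d, SegmentsCross (p a) (p b) (p c) (p d) ↔
      SegmentsCross (P a) (P b) (P c) (P d) := fun a b c d => segmentsCross_cast _ _ _ _
  have hgood := isGood_straight (G := graphB) hpi hpg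
  have hpc : ∀ e f z, (straight graphB p).CrossAt e f z → f = partner e := by
    intro e f z hc
    induction e with
    | _ a b =>
      induction f with
      | _ c d =>
        obtain ⟨hab, hcd, h, -⟩ := (crossAt_straight_iff hpg).1 hc
        exact hpart a b hab c d hcd ((hx _ _ _ _).1 h)
  have hu : ∀ a b, graphB.Adj a b → (∀ f z, ¬ (straight graphB p).CrossAt s(a, b) f z) →
      crossed s(a, b) = false := by
    intro a b hab hn
    by_contra hc
    obtain ⟨c, d, hcd, h⟩ := hcr a b hab (by simpa using hc)
    have h := (hx _ _ _ _).2 h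
    obtain ⟨z, h1, h2⟩ := h.exists_mem
    exact hn s(c, d) z ((crossAt_straight_iff hpg).2 ⟨hab, hcd, h, h1, h2⟩)
  have hfree : ∀ a b c, (straight graphB p).FreeTriangle a b c → graphB.Adj a b ∧
      graphB.Adj b c ∧ graphB.Adj c a ∧ crossed s(a, b) = false ∧ crossed s(b, c) = false ∧
      crossed s(c, a) = false := by
    rintro a b c ⟨⟨h1, h2, h3⟩, h⟩
    exact ⟨h1, h2, h3, hu a b h1 (h · · |>.1), hu b c h2 (h · · |>.2.1), hu c a h3 (h · · |>.2.2)⟩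
  -- Since `partner` is a function, an edge is crossed by at most one other edge, and goodness then
  -- gives at most one crossing point.
  refine ⟨⟨hgood, ?_⟩, isKTree_graphB, ?_, ?_, ?_, ?_, ?_⟩
  · intro e f f' z z' h1 h2
    obtain rfl : f = f' := (hpc e f z h1).trans (hpc e f' z' h2).symm
    exact ⟨rfl, hgood.cross_once e f z z' h1 h2⟩
  · refine encard_eq_of_finset {2, 6} 2 ?_ rfl
    ext w
    exact (isSimplicial_graphB_iff w).trans (by simp)
  · intro s t hs ht
    have : ∀ s t : Fin 7, s = 2 ∨ s = 6 → t = 2 ∨ t = 6 → ¬ graphB.Adj s t := by decide +kernel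
    exact this s t ((isSimplicial_graphB_iff s).1 hs) ((isSimplicial_graphB_iff t).1 ht)
  · intro w
    have : ∀ w, 4 ≤ (Finset.univ.filter (graphB.Adj w)).card := by decide +kernel
    change 4 ≤ (graphB.neighborSet w).encard
    rw [encard_eq_of_finset (S := graphB.neighborSet w) (Finset.univ.filter (graphB.Adj w)) _
      (by ext; simp) rfl]
    exact_mod_cast this w
  · intro a b c hf
    obtain ⟨h1, h2, h3, h4, h5, h6⟩ := hfree a b c hf
    change IsSimplicial graphB a ∨ IsSimplicial graphB b ∨ IsSimplicial graphB c
    simp only [isSimplicial_graphB_iff]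
    exact htri a b c h1 h2 h3 h4 h5 h6
  · intro s hs
    refine ⟨e s, e' s, fun b c hf => ?_⟩
    obtain ⟨h1, h2, h3, h4, h5, h6⟩ := hfree s b c hf
    exact htwo s ((isSimplicial_graphB_iff s).1 hs) b c h1 h2 h3 h4 h5 h6

theorem isTwoEnded_drawingB₁ : drawingB₁.IsTwoEnded := by
  have := isTwoEnded_straight_graphB
    ![(0, 22), (-12, 2), (12, 2), (-6, 5), (6, 5), (0, 12), (2, 8)] (by decide +kernel)
    (by decide +kernel)
    -- The final `else` serves u₅u₆; on uncrossed edges its value is irrelevant.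
    (fun e => if e = s(0, 3) then s(1, 5) else if e = s(1, 5) then s(0, 3) else
      if e = s(1, 4) then s(2, 3) else if e = s(2, 3) then s(1, 4) else
      if e = s(0, 6) then s(4, 5) else s(0, 6))
    (by decide +kernel)
    (fun e => e ∈ [s(0, 3), s(1, 5), s(1, 4), s(2, 3), s(0, 6), s(4, 5)])
    (by decide +kernel) (by decide +kernel)
    -- Opposite edges of the free triangles: u₁u₂ and u₁u₅ at u₃, and u₄u₅ and u₄u₆ at u₇.
    (fun s => if s = 2 then s(0, 1) else s(3, 4)) (fun s => if s = 2 then s(0, 4) else s(3, 5))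
    (by decide +kernel)
  convert this using 1
  unfold drawingB₁
  congr 1
  funext i
  fin_cases i <;> simp

theorem isTwoEnded_drawingB₂ : drawingB₂.IsTwoEnded := by
  have := isTwoEnded_straight_graphB
    ![(0, 22), (-12, 2), (12, 2), (-6, 5), (6, 5), (-2, 12), (2, 12)] (by decide +kernel)
    (by decide +kernel)
    (fun e => if e = s(0, 3) then s(1, 5) else if e = s(1, 5) then s(0, 3) else
      if e = s(1, 4) then s(2, 3) else if e = s(2, 3) then s(1, 4) else
      if e = s(3, 6) then s(4, 5) else s(3, 6))
    (by decide +kernel)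
    (fun e => e ∈ [s(0, 3), s(1, 5), s(1, 4), s(2, 3), s(3, 6), s(4, 5)])
    (by decide +kernel) (by decide +kernel)
    -- Here u₇ lies in the triangle u₁u₅u₆, so the opposite edges at u₇ are u₁u₅ and u₁u₆.
    (fun s => if s = 2 then s(0, 1) else s(0, 4)) (fun s => if s = 2 then s(0, 4) else s(0, 5))
    (by decide +kernel)
  convert this using 1
  unfold drawingB₂
  congr 1
  funext i
  fin_cases i <;> simp

theorem _root_.Phi.isTwoEnded {V : Type u} {D : Drawing V} (hD : Phi D) : D.IsTwoEnded := by
  induction hD with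
  | base₁ D h => exact isTwoEnded_drawingB₁.of_iso h
  | base₂ D h => exact isTwoEnded_drawingB₂.of_iso h
  | join D F₁ F₂ a b v₁ v₂ D' _ h ih => exact h.isTwoEnded ih
  | iso D D' _ h ih => exact ih.of_iso h

end Drawing

theorem lemma5p3 {V : Type*} (D : Drawing V) (hD : Phi D) :
    D.IsOnePlane ∧ IsOnePlanar D.graph ∧ IsKTree 4 D.graph ∧
      {w : V | IsSimplicial D.graph w}.encard = 2 :=
  ⟨hD.isTwoEnded.onePlane, ⟨D, rfl, hD.isTwoEnded.onePlane⟩, hD.isTwoEnded.kTree,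
    hD.isTwoEnded.encard_simplicial⟩
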